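/- Let $F$ be a field of characteristic $0$ and let $0\neq h\in F[x]$, written as $h=c\,u_1^{\alpha_1}\cdots u_t^{\alpha_t}$ with $c\in F\setminus\{0\}$, distinct monic irreducible polynomials $u_1,\dots,u_t$ and exponents $\alpha_i\ge 1$ (here $t=0$ is allowed). Let $A_h$ be the unital associative $F$-algebra generated by $x,y$ with the relation $yx=xy+h(x)$, and let $L=HH^1(A_h)$ be the Lie algebra of $F$-linear derivations of $A_h$ modulo inner derivations. For $f\in F[x]$ let $D_f$ be the derivation of $A_h$ with $D_f(x)=0$, $D_f(y)=f(x)$. Let $\pi_h$ be the monic polynomial that is a scalar multiple of $h/\gcd(h,h')$. Let $W$ be the Witt algebra over $F$, with basis $w_i$ ($i\ge -1$) and bracket $[w_m,w_n]=(n-m)w_{m+n}$. Embed $A_h$ in the Weyl algebra $A_1$ by $x\mapsto x$, $y\mapsto yh$, and put $a_n=\pi_h h^{n-1}y^n$ for $n\ge 0$ (in $A_1$ if $n\ge1$; $a_0=\pi_h h^{-1}$ lies in the localization of $A_1$ at the powers of $h$). For $r\in F[x]$ and $n\ge0$ the commutator with $r a_n$ restricts to a derivation $\mathrm{ad}_{r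 a_n}$ of $A_h$. Let $$\mathcal N=\operatorname{span}_F\Big\{\mathrm{ad}_{r a_n}\ \Big|\ r\in \Big(\prod_{i:\alpha_i\ge2}u_i\Big)F[x],\ n\ge0\Big\}\subseteq L .$$ Then: (1) $L=Z(L)\oplus[L,L]$, where $Z(L)$ is the center of $L$. Moreover $Z(L)=\{D_{r h/\pi_h}\mid r\in F[x],\ \deg r<\deg\pi_h\}$ and $\dim_F Z(L)=\deg\pi_h$. (2) $\mathcal N$ is the unique maximal nilpotent ideal of $[L,L]$ (it is a nilpotent ideal and contains every nilpotent ideal of $[L,L]$), and there is an isomorphism of Lie algebras over $F$ $$[L,L]/\mathcal N\;\cong\;\bigoplus_{i:\ \alpha_i\ge 2}\big(F[x]/F[x]u_i\big)\otimes_F W,$$ in which every summand is a simple Lie algebra over $F$. (3) If $\alpha_i\le 2$ for all $i$, then $\mathcal N=0$. In particular, if $\alpha_i=1$ for all $i$, then $[L,L]=0$; and if all $\alpha_i\le2$ and some $\alpha_i=2$, then $[L,L]\cong\bigoplus_{i:\alpha_i=2}(F[x]/F[x]u_i)\otimes_F W$ is a direct sum of simple Lie algebras obtained from $W$ by extending the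 scalars. (4) If $\alpha_i\ge 3$ for some $i$, then $\mathcal N\ne0$, and $[L,L]$ is neither nilpotent nor semisimple (it is not a direct sum of simple ideals, and its solvable radical is nonzero). -/

import Mathlib

open Polynomial
open scoped TensorProduct DirectSum

noncomputable section

/-! ### First Hochschild cohomology as the Lie algebra of outer derivations -/

namespace HH

section Der

attribute [local instance] LieRing.ofAssociativeRing

variable (F A : Type*) [Field F] [Ring A] [Algebra F A]

/-- `F`-linear derivations of a (possibly noncommutative) algebra, with the commutator bracket. -/
def derSubalgebra : LieSubalgebra F (Module.End F A) where
  carrier := {d | ∀ a b, d (a * b) = d a * b + a * d b}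
  add_mem' := by
    intro d e hd he a b
    simp only [LinearMap.add_apply, hd a b, he a b, add_mul, mul_add]
    abel
  zero_mem' := by intro a b; simp
  smul_mem' := by
    intro c d hd a b
    simp only [LinearMap.smul_apply, hd a b, smul_add, smul_mul_assoc, mul_smul_comm]
  lie_mem' := by
    intro d e hd he a b
    have hd' : ∀ a b, d (a * b) = d a * b + a * d b := hd
    have he' : ∀ a b, e (a * b) = e a * b + a * e b := he
    simp only [Ring.lie_def, LinearMap.sub_apply, Module.End.mul_apply, hd', he', map_add,
      sub_mul, mul_sub]
    abel

/-- The Lie algebra `Der_F(A)`. -/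
abbrev Der : Type _ := ↥(derSubalgebra F A)

instance : LieRing (Der F A) := inferInstanceAs (LieRing ↥(derSubalgebra F A))
instance : LieAlgebra F (Der F A) := inferInstanceAs (LieAlgebra F ↥(derSubalgebra F A))

variable {F A}

/-- The inner derivation `ad_a : b ↦ a b - b a`. -/
def innerDer (a : A) : Der F A :=
  ⟨LinearMap.mulLeft F a - LinearMap.mulRight F a, by
    intro b c
    simp only [LinearMap.sub_apply, LinearMap.mulLeft_apply, LinearMap.mulRight_apply, sub_mul,
      mul_sub, mul_assoc]
    abel⟩

theorem innerDer_apply (a b : A) : (innerDer (F := F) a).1 b = a * b - b * a := rfl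

theorem Der.leibniz (d : Der F A) (a b : A) : d.1 (a * b) = d.1 a * b + a * d.1 b := d.2 a b

variable (F A)

/-- The Lie ideal of inner derivations. -/
def innerIdeal : LieIdeal F (Der F A) where
  carrier := {d | ∃ a : A, innerDer a = d}
  add_mem' := by
    rintro _ _ ⟨a, rfl⟩ ⟨b, rfl⟩
    refine ⟨a + b, Subtype.ext (LinearMap.ext fun c => ?_)⟩
    change (a + b) * c - c * (a + b) = (a * c - c * a) + (b * c - c * b)
    simp only [add_mul, mul_add]; abel
  zero_mem' := ⟨0, Subtype.ext (LinearMap.ext fun c => by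
    change 0 * c - c * 0 = 0; simp)⟩
  smul_mem' := by
    rintro r _ ⟨a, rfl⟩
    refine ⟨r • a, Subtype.ext (LinearMap.ext fun c => ?_)⟩
    change (r • a) * c - c * (r • a) = r • (a * c - c * a)
    simp [smul_sub]
  lie_mem := by
    rintro d _ ⟨a, rfl⟩
    refine ⟨d.1 a, Subtype.ext (LinearMap.ext fun c => ?_)⟩
    change d.1 a * c - c * d.1 a = d.1 (a * c - c * a) - (a * d.1 c - d.1 c * a)
    rw [map_sub, d.leibniz, d.leibniz]; abel

/-- `HH¹(A) = Der(A) / Inn(A)`, with the Lie bracket induced by the commutator of derivations. -/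
def HH1 : Type _ := Der F A ⧸ innerIdeal F A

instance : LieRing (HH1 F A) := inferInstanceAs (LieRing (Der F A ⧸ innerIdeal F A))
instance : LieAlgebra F (HH1 F A) := inferInstanceAs (LieAlgebra F (Der F A ⧸ innerIdeal F A))

variable {F A}

/-- The class in `HH¹(A)` of a derivation. -/
def cls (d : Der F A) : HH1 F A := LieSubmodule.Quotient.mk (N := innerIdeal F A) d

end Der

variable {F : Type*} [Field F]

/-! ### The algebras `A_h` -/

/-- The defining relation `y x = x y + h(x)`; here `x = ι false` and `y = ι true`. -/
inductive Rel (h : F[X]) : FreeAlgebra F Bool → FreeAlgebra F Bool → Prop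
  | yx : Rel h (FreeAlgebra.ι F true * FreeAlgebra.ι F false)
      (FreeAlgebra.ι F false * FreeAlgebra.ι F true + aeval (FreeAlgebra.ι F false) h)

/-- The unital associative `F`-algebra generated by `x, y` subject to `y x = x y + h(x)`. -/
abbrev Alg (h : F[X]) : Type _ := RingQuot (Rel h)

/-- The generator `x` of `A_h`. -/
def x (h : F[X]) : Alg h := RingQuot.mkAlgHom F (Rel h) (FreeAlgebra.ι F false)

/-- The generator `y` of `A_h`. -/
def y (h : F[X]) : Alg h := RingQuot.mkAlgHom F (Rel h) (FreeAlgebra.ι F true)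

/-- The element `f(x)` of `A_h`, for a polynomial `f`. -/
def poly (h f : F[X]) : Alg h := aeval (x h) f

theorem y_mul_x (h : F[X]) : y h * x h = x h * y h + poly h h := by
  have := RingQuot.mkAlgHom_rel F (Rel.yx (h := h))
  simpa [x, y, poly, aeval_algHom_apply] using this

/-- The universal property of `A_h`. -/
def liftAlg {h : F[X]} {B : Type*} [Ring B] [Algebra F B] (a b : B)
    (hab : b * a = a * b + aeval a h) : Alg h →ₐ[F] B :=
  RingQuot.liftAlgHom F ⟨FreeAlgebra.lift F (fun i : Bool => if i then b else a), by
    rintro _ _ ⟨⟩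
    simp only [map_mul, map_add, FreeAlgebra.lift_ι_apply, ← aeval_algHom_apply]
    simpa using hab⟩

@[simp] theorem liftAlg_x {h : F[X]} {B : Type*} [Ring B] [Algebra F B] (a b : B)
    (hab : b * a = a * b + aeval a h) : liftAlg a b hab (x h) = a := by
  simp [liftAlg, x]

@[simp] theorem liftAlg_y {h : F[X]} {B : Type*} [Ring B] [Algebra F B] (a b : B)
    (hab : b * a = a * b + aeval a h) : liftAlg a b hab (y h) = b := by
  simp [liftAlg, y]

theorem algHom_ext {h : F[X]} {B : Type*} [Ring B] [Algebra F B] {φ ψ : Alg h →ₐ[F] B}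
    (hx : φ (x h) = ψ (x h)) (hy : φ (y h) = ψ (y h)) : φ = ψ := by
  apply RingQuot.ringQuot_ext'
  apply FreeAlgebra.hom_ext
  funext i
  cases i
  · exact hx
  · exact hy

/-- The algebra map `A_h → A_h ⊕ ε A_h` underlying the derivation `D_f`. -/
def polyDerHom (h f : F[X]) : Alg h →ₐ[F] TrivSqZeroExt (Alg h) (Alg h) :=
  liftAlg (TrivSqZeroExt.inl (x h)) (TrivSqZeroExt.inl (y h) + TrivSqZeroExt.inr (poly h f)) (by
    have e : aeval (TrivSqZeroExt.inl (x h) : TrivSqZeroExt (Alg h) (Alg h)) h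
        = TrivSqZeroExt.inl (poly h h) :=
      aeval_algHom_apply (TrivSqZeroExt.inlAlgHom F (Alg h) (Alg h)) (x h) h
    have c : poly h f * x h = x h * poly h f := by
      have := congrArg (aeval (x h)) (mul_comm f X)
      simpa [poly] using this
    rw [e]
    ext
    · simpa using y_mul_x h
    · simpa using c)

theorem polyDerHom_fst (h f : F[X]) (a : Alg h) : (polyDerHom h f a).fst = a := by
  have : (TrivSqZeroExt.fstHom F (Alg h) (Alg h)).comp (polyDerHom h f) = AlgHom.id F _ := by
    apply algHom_ext <;> simp [polyDerHom]
  exact congrArg (fun φ : Alg h →ₐ[F] Alg h => φ a) this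

/-- The derivation `D_f` of `A_h` with `D_f(x) = 0` and `D_f(y) = f(x)`. -/
def polyDer (h f : F[X]) : Der F (Alg h) :=
  ⟨(TrivSqZeroExt.sndHom (Alg h) (Alg h)).restrictScalars F ∘ₗ (polyDerHom h f).toLinearMap, by
    intro a b
    simp only [LinearMap.comp_apply, AlgHom.toLinearMap_apply, map_mul,
      LinearMap.restrictScalars_apply, TrivSqZeroExt.sndHom_apply, TrivSqZeroExt.snd_mul,
      polyDerHom_fst, smul_eq_mul, MulOpposite.smul_eq_mul_unop, MulOpposite.unop_op]
    abel⟩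

theorem polyDer_x (h f : F[X]) : (polyDer h f).1 (x h) = 0 := by
  simp [polyDer, polyDerHom]

theorem polyDer_y (h f : F[X]) : (polyDer h f).1 (y h) = poly h f := by
  simp [polyDer, polyDerHom]

/-! ### The polynomial `π_h` and the derivations `ad_{r a_n}` -/

/-- The monic polynomial `π_h = h / gcd(h, h')` (the quotient is exact, and is normalized). -/
def piPoly (h : F[X]) : F[X] :=
  open scoped Classical in normalize (h / EuclideanDomain.gcd h (derivative h))

theorem weyl_comm_poly (f : F[X]) :
    y (1 : F[X]) * poly 1 f = poly 1 f * y 1 + poly 1 (derivative f) := by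
  have h1 : y (1 : F[X]) * x 1 = x 1 * y 1 + 1 := by simpa [poly] using y_mul_x (1 : F[X])
  induction f using Polynomial.induction_on' with
  | add p q hp hq =>
    simp only [poly, map_add, mul_add, add_mul] at hp hq ⊢
    rw [hp, hq]; abel
  | monomial n a =>
    have key : ∀ n : ℕ, y (1 : F[X]) * x 1 ^ n = x 1 ^ n * y 1 + n • x (1 : F[X]) ^ (n - 1) := by
      intro n
      induction n with
      | zero => simp
      | succ n ih =>
        have e : (n • x (1 : F[X]) ^ (n - 1)) * x 1 = n • x (1 : F[X]) ^ n := by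
          cases n with
          | zero => simp
          | succ m => rw [smul_mul_assoc, Nat.add_sub_cancel, ← pow_succ]
        rw [pow_succ, ← mul_assoc, ih, add_mul, mul_assoc, h1, mul_add, mul_one, e, succ_nsmul,
          Nat.add_sub_cancel, mul_assoc]
        abel
    simp only [poly, derivative_monomial, aeval_monomial]
    rw [← mul_assoc, ← Algebra.commutes, mul_assoc, key n, mul_add, map_mul, map_natCast,
      mul_assoc, mul_assoc, nsmul_eq_mul]

/-- The embedding of `A_h` in the Weyl algebra `A_1`, given by `x ↦ x` and `y ↦ y h(x)`. -/
def toWeyl (h : F[X]) : Alg h →ₐ[F] Alg (1 : F[X]) :=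
  liftAlg (x 1) (y 1 * poly 1 h) (by
    have h1 : y (1 : F[X]) * x 1 = x 1 * y 1 + 1 := by simpa [poly] using y_mul_x (1 : F[X])
    have c : poly 1 h * x (1 : F[X]) = x 1 * poly 1 h := by
      have := congrArg (aeval (x (1 : F[X]))) (mul_comm h X)
      simpa [poly] using this
    rw [mul_assoc, c, ← mul_assoc, h1, add_mul, one_mul, mul_assoc]
    rfl)

/-- `IsAdRA h r n d` says that `d` is the derivation `ad_{r a_n}` of `A_h`, where
`a_n = π_h h^(n-1) y^n`.  For `n ≥ 1` the element `a_n` lies in the Weyl algebra `A_1 ⊇ A_h`, and `d`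
is the restriction to `A_h` of the commutator with `r a_n`.  The element `a_0 = π_h h⁻¹` lies in
the localization of `A_1` at the powers of `h(x)`: there the commutator of `r π_h h⁻¹` with `x` is
`0`, and with `y h(x)` it is `- h (r π_h h⁻¹)' = r (π_h h' / h) - (r π_h)'`, a polynomial because
`h` divides `π_h h'`. -/
def IsAdRA (h r : F[X]) : ℕ → Der F (Alg h) → Prop
  | 0, d => d = polyDer h (r * (piPoly h * derivative h / h) - derivative (r * piPoly h))
  | n + 1, d => ∀ z : Alg h, toWeyl h (d.1 z) =
      poly 1 (r * piPoly h * h ^ n) * y 1 ^ (n + 1) * toWeyl h z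
        - toWeyl h z * (poly 1 (r * piPoly h * h ^ n) * y 1 ^ (n + 1))

/-- The subspace of `HH¹(A_h)` spanned by the classes of `ad_{r a_n}`, for `r ∈ v F[x]`
and `n ≥ 0`. -/
def adSpan (h v : F[X]) : Submodule F (HH1 F (Alg h)) :=
  Submodule.span F {c | ∃ (r : F[X]) (n : ℕ) (d : Der F (Alg h)),
    v ∣ r ∧ IsAdRA h r n d ∧ c = cls d}

/-- The derived algebra `[L, L]` of a Lie algebra `L`, as a Lie ideal. -/
abbrev derivedIdeal (F L : Type*) [Field F] [LieRing L] [LieAlgebra F L] : LieIdeal F L :=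
  ⁅(⊤ : LieIdeal F L), (⊤ : LieIdeal F L)⁆

/-! ### The Witt algebra -/

/-- The vector space with basis `w_i`, `i ≥ -1`. -/
def Witt (F : Type*) [Field F] : Type _ := {i : ℤ // -1 ≤ i} →₀ F

namespace Witt

instance : AddCommGroup (Witt F) := inferInstanceAs (AddCommGroup ({i : ℤ // -1 ≤ i} →₀ F))
instance : Module F (Witt F) := inferInstanceAs (Module F ({i : ℤ // -1 ≤ i} →₀ F))

variable (F) in
/-- The basis of the Witt algebra. -/
def basis : Module.Basis {i : ℤ // -1 ≤ i} F (Witt F) := ⟨LinearEquiv.refl F _⟩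

variable (F) in
/-- The basis element `w_i` for `i ≥ -1` (and `0` for `i < -1`). -/
def w (i : ℤ) : Witt F := if hi : -1 ≤ i then basis F ⟨i, hi⟩ else 0

variable (F) in
/-- The bilinear map with `(w_m, w_n) ↦ (n - m) w_{m+n}`. -/
def bracketMap : Witt F →ₗ[F] Witt F →ₗ[F] Witt F :=
  (basis F).constr F fun m => (basis F).constr F fun n => ((n.1 - m.1 : ℤ) : F) • w F (m.1 + n.1)

theorem bracketMap_w {m n : ℤ} (hm : -1 ≤ m) (hn : -1 ≤ n) :
    bracketMap F (w F m) (w F n) = ((n - m : ℤ) : F) • w F (m + n) := by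
  simp [bracketMap, w, hm, hn, Module.Basis.constr_basis]

theorem bracketMap_bracketMap_w {i j k : ℤ} (hi : -1 ≤ i) (hj : -1 ≤ j) (hk : -1 ≤ k) :
    bracketMap F (w F i) (bracketMap F (w F j) (w F k)) =
      (((k - j) * (j + k - i) : ℤ) : F) • w F (i + j + k) := by
  rw [bracketMap_w hj hk, map_smul]
  by_cases hjk : -1 ≤ j + k
  · rw [bracketMap_w hi hjk, smul_smul, ← Int.cast_mul, add_assoc]
  · have : k - j = 0 := by omega
    simp [this]

theorem basis_eq_w (i : {i : ℤ // -1 ≤ i}) : basis F i = w F i.1 := by simp [w, i.2]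

theorem bracketMap_skew (a b : Witt F) : bracketMap F a b = - bracketMap F b a := by
  have : bracketMap F = -(bracketMap F).flip := by
    refine (basis F).ext fun i => (basis F).ext fun j => ?_
    simp only [LinearMap.neg_apply, LinearMap.flip_apply, basis_eq_w]
    rw [bracketMap_w i.2 j.2, bracketMap_w j.2 i.2, ← neg_smul, add_comm j.1, ← Int.cast_neg]
    congr 2
    ring
  exact congrArg (fun φ : Witt F →ₗ[F] Witt F →ₗ[F] Witt F => φ a b) this

theorem bracketMap_self (a : Witt F) : bracketMap F a a = 0 := by
  have ha : a ∈ Submodule.span F (Set.range (basis F)) := (basis F).mem_span a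
  induction ha using Submodule.span_induction with
  | mem a ha =>
    obtain ⟨i, rfl⟩ := ha
    rw [basis_eq_w, bracketMap_w i.2 i.2]
    simp
  | zero => simp
  | add a b _ _ iha ihb =>
    simp only [map_add, LinearMap.add_apply, iha, ihb]
    rw [bracketMap_skew a b]
    simp
  | smul c a _ ih => simp [ih]

theorem bracketMap_jacobi (a b c : Witt F) :
    bracketMap F a (bracketMap F b c) =
      bracketMap F (bracketMap F a b) c + bracketMap F b (bracketMap F a c) := by
  let B := bracketMap F
  let L : Witt F →ₗ[F] Witt F →ₗ[F] Witt F →ₗ[F] Witt F :=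
    LinearMap.mk₂ F (fun a b => B a ∘ₗ B b)
      (by intros; ext; simp) (by intros; ext; simp) (by intros; ext; simp) (by intros; ext; simp)
  let R : Witt F →ₗ[F] Witt F →ₗ[F] Witt F →ₗ[F] Witt F :=
    LinearMap.mk₂ F (fun a b => B (B a b) + B b ∘ₗ B a)
      (by intros; ext; simp; abel) (by intros; ext; simp) (by intros; ext; simp; abel)
      (by intros; ext; simp)
  have : L = R := by
    refine (basis F).ext fun i => (basis F).ext fun j => (basis F).ext fun k => ?_
    simp only [L, R, B, LinearMap.mk₂_apply, LinearMap.comp_apply, LinearMap.add_apply, basis_eq_w]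
    rw [bracketMap_skew (bracketMap F (w F i.1) (w F j.1)), bracketMap_bracketMap_w i.2 j.2 k.2,
      bracketMap_bracketMap_w k.2 i.2 j.2, bracketMap_bracketMap_w j.2 i.2 k.2,
      show k.1 + i.1 + j.1 = i.1 + j.1 + k.1 by ring,
      show j.1 + i.1 + k.1 = i.1 + j.1 + k.1 by ring, ← neg_smul, ← add_smul, ← Int.cast_neg,
      ← Int.cast_add]
    congr 2
    ring
  exact congrArg (fun φ : Witt F →ₗ[F] Witt F →ₗ[F] Witt F →ₗ[F] Witt F => φ a b c) this

instance : LieRing (Witt F) where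
  bracket a b := bracketMap F a b
  add_lie a b c := by simp
  lie_add a b c := by simp
  lie_self a := bracketMap_self a
  leibniz_lie a b c := bracketMap_jacobi a b c

instance : LieAlgebra F (Witt F) where
  lie_smul c a b := by simp [Bracket.bracket]

theorem lie_w {m n : ℤ} (hm : -1 ≤ m) (hn : -1 ≤ n) :
    ⁅w F m, w F n⁆ = ((n - m : ℤ) : F) • w F (m + n) := bracketMap_w hm hn

end Witt

/-- The Lie algebra `(F[x] / u F[x]) ⊗ W` over `F`, with `⁅a ⊗ w, b ⊗ w'⁆ = a b ⊗ ⁅w, w'⁆`. -/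
def WittExt (u : F[X]) : Type _ := (F[X] ⧸ Ideal.span {u}) ⊗[F] Witt F

instance (u : F[X]) : LieRing (WittExt u) :=
  inferInstanceAs (LieRing ((F[X] ⧸ Ideal.span {u}) ⊗[F] Witt F))
instance (u : F[X]) : LieAlgebra F (WittExt u) :=
  inferInstanceAs (LieAlgebra F ((F[X] ⧸ Ideal.span {u}) ⊗[F] Witt F))

theorem WittExt.lie_tmul (u : F[X]) (a b : F[X] ⧸ Ideal.span {u}) (v w : Witt F) :
    (⁅(show WittExt u from a ⊗ₜ[F] v), (show WittExt u from b ⊗ₜ[F] w)⁆ : WittExt u) =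
      (show WittExt u from (a * b) ⊗ₜ[F] ⁅v, w⁆) := rfl

end HH

end

/-! Write `h = π q` with `π` the radical of `h`, and put `θ = π q' / q`, a polynomial coprime to
`q`. Let `K` be a ring of power series in which `h` is invertible, with `δ` extending `h d/dx`. The
algebra `A_h` sits in the Ore extension `K[T; δ]` with `y = T`, and there derivations of `A_h`
become commutators: `D_f` is the commutator with `-g` where `δ g = f`, and every derivation is some
`D_f` plus the commutator with some `q⁻¹ a`, `a ∈ A_h` (`exists_eq_add`). The terms of order at
least two in `[q⁻¹ a, q⁻¹ b]` fall into `A_h`, so modulo inner derivations only the bracket `{a, b}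
= a_T ∇b - b_T ∇a` survives, with `∇ = π ∂_x - θ` (`commutator_frac`). The classes of the
commutators with `q⁻¹ a` thus form the Lie algebra `F[x, T] / (q)` with this bracket.

The map induced by `∇` on `F[x] / q` is injective, hence bijective by finite dimension. So each
`D_f` is some `D_{rq}`, which is central, plus the commutator with some `q⁻¹ s`. Since `{1, b} = θ
b_T` and `θ` is a unit modulo `q`, the algebra `F[x, T] / (q)` is perfect; it also has trivial
center. Hence it is `[L, L]`, and the classes of the `D_{rq}` are `Z(L)`.

Let `v` be the product of the `u_i` with `α_i ≥ 2`, the radical of `q`. As `v ∣ π`, the bracket of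
multiples of `v^i` and `v^k` is a multiple of `v^(i+k)`, so the multiples of `v` form a nilpotent
ideal. Modulo `v` the map `∇` is multiplication by `-θ`, and after rescaling by `θ` the bracket
becomes `f g_T - f_T g`, that of the vector fields `f ∂_T` over `F[x] / v = ∏ F[x] / u_i`: a sum of
Witt algebras. Bracketing with `1` lowers the degree in `T`, so an ideal not inside `(v)` contains
an element that is constant in `T` and nonzero modulo `v`. This yields both the simplicity of the
summands and the maximality of the nilpotent ideal, which vanishes exactly when `q ∣ v`, that is,
when all `α_i ≤ 2`. -/

noncomputable section

namespace HH

/-! ### Logarithmic derivatives and the factorization `h = π q`. -/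

section Factorization

variable {F : Type*} [Field F]

/-- `π` is the radical of `h = π q`, and `θ = π q' / q`, with the divisibility properties that
govern the outer derivations of `A_h`. -/
structure RadicalFactor (h π q θ : F[X]) : Prop where
  monic : π.Monic
  eq_mul : h = π * q
  ne_zero : q ≠ 0
  log_deriv : q * θ = π * derivative q
  coprime : IsCoprime θ q
  dvd_of_dvd : ∀ s, q ∣ π * derivative s - θ * s → q ∣ s
  dvd_of_derivative : ∀ a, h ∣ derivative h * a → π ∣ a

variable {ι : Type*} [Fintype ι] [DecidableEq ι]

/-- The numerator `∑ βᵢ uᵢ' ∏_{j ≠ i} uⱼ` of the logarithmic derivative of `∏ uᵢ ^ βᵢ`. -/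
def logNum (u : ι → F[X]) (β : ι → ℕ) : F[X] :=
  ∑ i, (β i : F[X]) * derivative (u i) * ∏ j ∈ Finset.univ.erase i, u j

theorem prod_mul_derivative_prod_pow (u : ι → F[X]) (β : ι → ℕ) :
    (∏ i, u i) * derivative (∏ i, u i ^ β i) = (∏ i, u i ^ β i) * logNum u β := by
  rw [derivative_prod_finset, logNum, Finset.mul_sum, Finset.mul_sum]
  refine Finset.sum_congr rfl fun i _ => ?_
  rw [← Finset.mul_prod_erase _ u (Finset.mem_univ i),
    ← Finset.mul_prod_erase _ (fun i => u i ^ β i) (Finset.mem_univ i), derivative_pow]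
  rcases Nat.eq_zero_or_pos (β i) with hb | hb
  · simp [hb]
  · obtain ⟨k, hk⟩ := Nat.exists_eq_add_of_lt hb
    rw [hk]
    simp only [zero_add, Nat.add_sub_cancel, map_natCast]
    ring

variable [CharZero F]

theorem not_dvd_derivative {p : F[X]} (hp : Irreducible p) : ¬ p ∣ derivative p := by
  have := hp.separable
  intro hd
  exact hp.not_isUnit (this.isUnit_of_dvd' dvd_rfl hd)

variable {u : ι → F[X]} (hmonic : ∀ i, (u i).Monic) (hirr : ∀ i, Irreducible (u i))
  (hinj : Function.Injective u)

omit [CharZero F] in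
theorem isCoprime_of_monic_irreducible {p r : F[X]} (hp : p.Monic) (hr : r.Monic)
    (hpi : Irreducible p) (hri : Irreducible r) (hne : p ≠ r) : IsCoprime p r := by
  refine hpi.coprime_iff_not_dvd.2 fun hd => hne ?_
  exact eq_of_monic_of_associated hp hr (hpi.associated_of_dvd hri hd)

omit [CharZero F] in
include hmonic hirr hinj in
theorem isCoprime_prod_erase (i : ι) : IsCoprime (u i) (∏ j ∈ Finset.univ.erase i, u j) := by
  refine IsCoprime.prod_right fun j hj => ?_
  exact isCoprime_of_monic_irreducible (hmonic i) (hmonic j) (hirr i) (hirr j)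
    fun e => (Finset.ne_of_mem_erase hj) (hinj e).symm

omit [CharZero F] in
theorem dvd_logNum_sub (β : ι → ℕ) (i : ι) :
    u i ∣ logNum u β - (β i : F[X]) * derivative (u i) * ∏ j ∈ Finset.univ.erase i, u j := by
  rw [logNum, ← Finset.add_sum_erase _ _ (Finset.mem_univ i), add_sub_cancel_left]
  refine Finset.dvd_sum fun k hk => Dvd.dvd.mul_left ?_ _
  exact Finset.dvd_prod_of_mem _ (Finset.mem_erase.2 ⟨(Finset.ne_of_mem_erase hk).symm,
    Finset.mem_univ i⟩)

include hmonic hirr hinj in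
theorem dvd_of_dvd_mul_derivative_mul_prod (i : ι) {c : F} (hc : c ≠ 0) {w : F[X]}
    (hd : u i ∣ C c * derivative (u i) * (∏ j ∈ Finset.univ.erase i, u j) * w) : u i ∣ w := by
  refine ((hirr i).prime.dvd_or_dvd hd).resolve_left fun hd => ?_
  rcases (hirr i).prime.dvd_or_dvd hd with hd | hd
  · rcases (hirr i).prime.dvd_or_dvd hd with hd | hd
    · exact (hirr i).not_isUnit (isUnit_of_dvd_unit hd (isUnit_C.2 hc.isUnit))
    · exact not_dvd_derivative (hirr i) hd
  · exact (hirr i).not_isUnit ((isCoprime_prod_erase hmonic hirr hinj i).isUnit_of_dvd' dvd_rfl hd)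

include hmonic hirr hinj in
theorem isCoprime_logNum (β : ι → ℕ) (i : ι) (hβ : β i ≠ 0) : IsCoprime (logNum u β) (u i) := by
  refine ((hirr i).coprime_iff_not_dvd.2 fun hd => ?_).symm
  have h1 := (dvd_sub_right hd).1 (dvd_logNum_sub (u := u) β i)
  have h2 : u i ∣ (1 : F[X]) :=
    dvd_of_dvd_mul_derivative_mul_prod hmonic hirr hinj i (c := (β i : F)) (by exact_mod_cast hβ)
      (by simpa using h1)
  exact (hirr i).not_isUnit (isUnit_of_dvd_one h2)

omit [DecidableEq ι] [CharZero F] in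
include hmonic hirr hinj in
theorem prod_pow_dvd_of_forall (β : ι → ℕ) (s : F[X]) (hs : ∀ i, u i ^ β i ∣ s) :
    ∏ i, u i ^ β i ∣ s := by
  refine Finset.prod_dvd_of_coprime (fun i _ j _ hij => ?_) fun i _ => hs i
  exact (isCoprime_of_monic_irreducible (hmonic i) (hmonic j) (hirr i) (hirr j)
    fun e => hij (hinj e)).pow

-- If `s = u_i^k w` with `k < β_i`, then modulo `u_i^(k+1)` the expression `π s' - θ s` equals `(k -
-- β_i) u_i' (∏_{j ≠ i} u_j) u_i^k w`. In characteristic zero the scalar is nonzero and `u_i`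
-- divides neither `u_i'` nor the product, so `u_i ∣ w` and the exponent climbs to `β_i`.
include hmonic hirr hinj in
theorem prod_pow_dvd_of_dvd_connection (β : ι → ℕ) (s : F[X])
    (hs : ∏ i, u i ^ β i ∣ (∏ i, u i) * derivative s - logNum u β * s) :
    ∏ i, u i ^ β i ∣ s := by
  refine prod_pow_dvd_of_forall hmonic hirr hinj β s fun i => ?_
  suffices ∀ k, k ≤ β i → u i ^ k ∣ s from this _ le_rfl
  intro k
  induction k with
  | zero => simp
  | succ k ih =>
    intro hk
    obtain ⟨w, rfl⟩ := ih (by omega)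
    obtain ⟨e, he⟩ := dvd_logNum_sub (u := u) β i
    obtain ⟨z, hz⟩ := ((pow_dvd_pow (u i) hk).trans
      (Finset.dvd_prod_of_mem (fun i => u i ^ β i) (Finset.mem_univ i))).trans hs
    have hne : u i ≠ 0 := (hirr i).ne_zero
    rw [pow_succ]
    refine mul_dvd_mul_left _ ?_
    rw [← Finset.mul_prod_erase _ u (Finset.mem_univ i)] at hz
    have hkd : u i * derivative (u i ^ k) = (k : F[X]) * derivative (u i) * u i ^ k := by
      cases k with
      | zero => simp
      | succ k => rw [derivative_pow]; simp only [Nat.add_sub_cancel, map_natCast]; ring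
    have hz' : u i ^ k * (((k : F[X]) * derivative (u i) * (∏ j ∈ Finset.univ.erase i, u j)) * w
        + u i * (∏ j ∈ Finset.univ.erase i, u j) * derivative w - logNum u β * w)
        = u i ^ k * (u i * z) := by
      rw [derivative_mul] at hz
      linear_combination hz - (∏ j ∈ Finset.univ.erase i, u j) * w * hkd
    have hz'' := mul_left_cancel₀ (pow_ne_zero k hne) hz'
    refine dvd_of_dvd_mul_derivative_mul_prod hmonic hirr hinj i
      (c := (k : F) - (β i : F)) ?_ ?_
    · rw [sub_ne_zero]; exact_mod_cast (by omega : k ≠ β i)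
    · refine ⟨z - (∏ j ∈ Finset.univ.erase i, u j) * derivative w + e * w, ?_⟩
      simp only [map_sub, map_natCast]
      linear_combination hz'' + w * he

-- Here `q` has exponents `α_i - 1`, so `θ` is the numerator of its logarithmic derivative. The
-- simple factors of `h` do not divide `q`, so coprimality is needed only at the multiple ones.
include hmonic hirr hinj in
theorem radicalFactor_prod (α : ι → ℕ) (hα : ∀ i, 1 ≤ α i) {c : F} (hc : c ≠ 0) {h : F[X]}
    (hh : h = C c * ∏ i, u i ^ α i) :
    RadicalFactor h (∏ i, u i) (C c * ∏ i, u i ^ (α i - 1)) (logNum u fun i => α i - 1) := by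
  have hC : IsUnit (C c : F[X]) := isUnit_C.2 hc.isUnit
  have hπ : (∏ i, u i).Monic := monic_prod_of_monic _ _ fun i _ => hmonic i
  have hq : ∏ i, u i ^ (α i - 1) ≠ 0 :=
    Finset.prod_ne_zero_iff.2 fun i _ => pow_ne_zero _ (hirr i).ne_zero
  have hmul : ∏ i, u i ^ α i = (∏ i, u i) * ∏ i, u i ^ (α i - 1) := by
    rw [← Finset.prod_mul_distrib]
    refine Finset.prod_congr rfl fun i _ => ?_
    rw [← pow_succ', Nat.sub_add_cancel (hα i)]
  refine ⟨hπ, by rw [hh, hmul]; ring, mul_ne_zero (by simpa using hc) hq, ?_, ?_, ?_, ?_⟩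
  · have := prod_mul_derivative_prod_pow u fun i => α i - 1
    rw [derivative_C_mul]
    linear_combination -C c * this
  · refine (isCoprime_mul_unit_left_right hC _ _).2 (IsCoprime.prod_right fun i _ => ?_)
    rcases Nat.eq_zero_or_pos (α i - 1) with h0 | h0
    · rw [h0, pow_zero]; exact isCoprime_one_right
    · exact (isCoprime_logNum hmonic hirr hinj _ i h0.ne').pow_right
  · intro s hs
    rw [hC.mul_left_dvd] at hs ⊢
    exact prod_pow_dvd_of_dvd_connection hmonic hirr hinj _ s hs
  · intro a ha
    have h1 : (∏ i, u i) * derivative h = h * logNum u α := by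
      rw [hh, derivative_C_mul]
      linear_combination C c * prod_mul_derivative_prod_pow u α
    have h2 : (∏ i, u i) ∣ logNum u α * a := by
      have h0 : h ≠ 0 := by
        rw [hh, hmul]
        exact mul_ne_zero (by simpa using hc) (mul_ne_zero hπ.ne_zero hq)
      refine (mul_dvd_mul_iff_left h0).1 ?_
      obtain ⟨z, hz⟩ := ha
      exact ⟨z, by linear_combination (∏ i, u i) * hz - a * h1⟩
    refine IsCoprime.dvd_of_dvd_mul_left ?_ h2
    exact (IsCoprime.prod_right fun i _ => isCoprime_logNum hmonic hirr hinj α i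
      (by have := hα i; omega)).symm

-- Since `h' = q (π' + θ)` and the second factor is coprime to `π`, the gcd of `h` and `h'` is
-- associated to `q`.
omit [CharZero F] in
theorem piPoly_eq_of_radicalFactor {h π q θ : F[X]} (H : RadicalFactor h π q θ)
    (hcop : IsCoprime π (derivative π + θ)) : piPoly h = π := by
  classical
  have hd : derivative h = q * (derivative π + θ) := by
    rw [H.eq_mul, derivative_mul]; linear_combination -H.log_deriv
  have hg : Associated (EuclideanDomain.gcd h (derivative h)) q := by
    refine associated_of_dvd_dvd ?_ (EuclideanDomain.dvd_gcd ⟨π, by rw [H.eq_mul, mul_comm]⟩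
      ⟨_, hd⟩)
    obtain ⟨a, b, hab⟩ := hcop
    have : q = a * h + b * derivative h := by
      rw [hd, H.eq_mul]; linear_combination -q * hab
    rw [this]
    exact dvd_add ((EuclideanDomain.gcd_dvd_left _ _).mul_left _)
      ((EuclideanDomain.gcd_dvd_right _ _).mul_left _)
  obtain ⟨e, he⟩ := hg
  have hne : EuclideanDomain.gcd h (derivative h) ≠ 0 := fun h0 => H.ne_zero (by rw [← he, h0,
    zero_mul])
  have : h / EuclideanDomain.gcd h (derivative h) = π * e := by
    refine EuclideanDomain.eq_div_of_mul_eq_left hne ?_ |>.symm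
    rw [mul_assoc, mul_comm (e : F[X]), he, ← H.eq_mul]
  unfold piPoly
  rw [this]
  have h1 := normalize_eq_normalize_iff_associated.2 (associated_mul_unit_left π (e : F[X]) e.isUnit)
  convert h1.trans H.monic.normalize_eq_self

include hmonic hirr hinj in
theorem piPoly_prod (α : ι → ℕ) (hα : ∀ i, 1 ≤ α i) {c : F} (hc : c ≠ 0) {h : F[X]}
    (hh : h = C c * ∏ i, u i ^ α i) : piPoly h = ∏ i, u i := by
  refine piPoly_eq_of_radicalFactor (radicalFactor_prod hmonic hirr hinj α hα hc hh) ?_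
  have : derivative (∏ i, u i) + (logNum u fun i => α i - 1) = logNum u α := by
    rw [derivative_prod_finset, logNum, logNum, ← Finset.sum_add_distrib]
    refine Finset.sum_congr rfl fun i _ => ?_
    rw [Nat.cast_sub (hα i)]; push_cast; ring
  rw [this]
  exact (IsCoprime.prod_right fun i _ => isCoprime_logNum hmonic hirr hinj α i
      (by have := hα i; omega)).symm

end Factorization

/-! ### The Ore extension `R[T; δ]` acting on `R[T]` by left multiplication. -/

section Ore

variable {F R : Type*} [Field F] [CommRing R] [Algebra F R] (δ : Derivation F R R)

/-- The coefficientwise action of a derivation on polynomials. -/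
def coefDer : Derivation F R[X] R[X] :=
  Derivation.mk' (lsum fun n => ((monomial n : R →ₗ[R] R[X]).restrictScalars F) ∘ₗ δ.toLinearMap)
  <| by
    intro a b
    induction a using Polynomial.induction_on' with
    | add p q hp hq => simp only [add_mul, map_add, add_smul, smul_add, hp, hq]; abel
    | monomial n a =>
      induction b using Polynomial.induction_on' with
      | add p q hp hq => simp only [mul_add, map_add, add_smul, smul_add, hp, hq]; abel
      | monomial m b =>
        simp [monomial_mul_monomial, lsum_apply, sum_monomial_index, add_comm]

theorem coefDer_monomial (n : ℕ) (a : R) : coefDer δ (monomial n a) = monomial n (δ a) := by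
  simp [coefDer, lsum_apply, sum_monomial_index]

@[simp] theorem coefDer_C (a : R) : coefDer δ (C a) = C (δ a) := coefDer_monomial δ 0 a

@[simp] theorem coefDer_X : coefDer δ X = 0 := by
  rw [← monomial_one_one_eq_X, coefDer_monomial]; simp

@[simp] theorem coeff_coefDer (p : R[X]) (n : ℕ) : (coefDer δ p).coeff n = δ (p.coeff n) := by
  induction p using Polynomial.induction_on' with
  | add p q hp hq => simp [hp, hq]
  | monomial m a => rw [coefDer_monomial, coeff_monomial, coeff_monomial]; split_ifs <;> simp

/-- The operator `T + δ` on `R[T]`, by which the generator of the Ore extension `R[T; δ]` acts from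
the left on `R[T; δ] = ⨁ R Tⁿ`. -/
def oreY : Module.End F R[X] := LinearMap.mulLeft F X + (coefDer δ).toLinearMap

theorem oreY_apply (p : R[X]) : oreY δ p = X * p + coefDer δ p := rfl

/-- Left multiplication by `∑ pₙ Tⁿ` in the Ore extension `R[T; δ]`, whose elements are written as
polynomials in `T` with coefficients on the left. -/
def op : R[X] →ₗ[F] Module.End F R[X] :=
  lsum fun n => LinearMap.mulRight F (oreY δ ^ n) ∘ₗ (LinearMap.mul F R[X]) ∘ₗ
    (CAlgHom (R := F) (A := R)).toLinearMap

theorem op_monomial (n : ℕ) (a : R) :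
    op δ (monomial n a) = LinearMap.mulLeft F (C a) * oreY δ ^ n := by
  simp only [op, lsum_apply, LinearMap.comp_apply]
  rw [sum_monomial_index _ _ (by simp)]
  rfl

@[simp] theorem op_C (a : R) : op δ (C a) = LinearMap.mulLeft F (C a) := by
  rw [← monomial_zero_left, op_monomial, pow_zero, mul_one, monomial_zero_left]

@[simp] theorem op_X_pow (n : ℕ) : op δ (X ^ n) = oreY δ ^ n := by
  rw [X_pow_eq_monomial, op_monomial, map_one]
  ext1; simp

@[simp] theorem op_X : op δ X = oreY δ := by simpa using op_X_pow δ 1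

theorem op_C_mul (a : R) (p : R[X]) : op δ (C a * p) = LinearMap.mulLeft F (C a) * op δ p := by
  induction p using Polynomial.induction_on' with
  | add p q hp hq => rw [mul_add, map_add, map_add, mul_add, hp, hq]
  | monomial n b =>
    rw [C_mul_monomial, op_monomial, op_monomial, ← mul_assoc]
    congr 1
    ext1 z; simp

theorem op_C_mul_apply (a : R) (p z : R[X]) : op δ (C a * p) z = C a * op δ p z := by
  rw [op_C_mul]; rfl

theorem oreY_mul_mulLeft (a : R) : oreY δ * LinearMap.mulLeft F (C a) =
    LinearMap.mulLeft F (C a) * oreY δ + LinearMap.mulLeft F (C (δ a)) := by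
  ext1 z
  simp only [Module.End.mul_apply, LinearMap.mulLeft_apply, LinearMap.add_apply, oreY_apply,
    Derivation.leibniz, coefDer_C, smul_eq_mul]
  ring

theorem op_oreY (p : R[X]) : op δ (oreY δ p) = oreY δ * op δ p := by
  induction p using Polynomial.induction_on' with
  | add p q hp hq => rw [map_add, map_add, map_add, mul_add, hp, hq]
  | monomial n a =>
    rw [oreY_apply, map_add, coefDer_monomial, X_mul_monomial, op_monomial, op_monomial,
      op_monomial, ← mul_assoc, oreY_mul_mulLeft, add_mul, pow_succ', mul_assoc]

theorem op_apply_one (p : R[X]) : op δ p 1 = p := by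
  have hn : ∀ n, (oreY δ ^ n) (1 : R[X]) = X ^ n := by
    intro n
    induction n with
    | zero => simp
    | succ n ih =>
      rw [pow_succ', Module.End.mul_apply, ih, oreY_apply, Derivation.leibniz_pow]
      simp [pow_succ']
  induction p using Polynomial.induction_on' with
  | add p q hp hq => rw [map_add, LinearMap.add_apply, hp, hq]
  | monomial n a =>
    rw [op_monomial, Module.End.mul_apply, hn, LinearMap.mulLeft_apply, C_mul_X_pow_eq_monomial]

theorem op_injective : Function.Injective (op δ) := fun p q e => by
  rw [← op_apply_one δ p, e, op_apply_one]

/-- This is associativity of the Ore product `p ∗ q = op δ p q`: the twisted product never has to be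
given a ring structure of its own. -/
theorem op_op (p q : R[X]) : op δ (op δ p q) = op δ p * op δ q := by
  induction p using Polynomial.induction_on' with
  | add p r hp hq => rw [map_add, LinearMap.add_apply, map_add, add_mul, hp, hq]
  | monomial n a =>
    rw [op_monomial, Module.End.mul_apply, LinearMap.mulLeft_apply, op_C_mul, mul_assoc]
    congr 1
    induction n with
    | zero => simp
    | succ n ih => rw [pow_succ', Module.End.mul_apply, op_oreY, ih, mul_assoc]

end Ore

/-! ### A differential extension of `F[x]` and commutators with `x`. -/

section Model

variable {F K : Type*} [Field F] [CommRing K] [Algebra F K]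

/-- An extension `K` of `F[x]` with a derivation extending `h d/dx`, in which `h` is invertible and
polynomials have antiderivatives. -/
structure DiffExtension (h : F[X]) (j : F[X] →ₐ[F] K) (δ : Derivation F K K) : Prop where
  injective : Function.Injective j
  map_derivative : ∀ f, δ (j f) = j (h * derivative f)
  isUnit : IsUnit (j h)
  exists_antiderivative : ∀ f, ∃ g, δ g = j f

theorem exists_eval_ne_zero [CharZero F] {h : F[X]} (hh : h ≠ 0) : ∃ c, h.eval c ≠ 0 := by
  by_contra! hc
  exact hh (funext fun c => by simpa using hc c)

-- Taylor expansion at a point `c` with `h(c) ≠ 0` makes `h` an invertible power series, and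
-- characteristic zero permits termwise integration.
open scoped PowerSeries in
theorem exists_diffExtension [CharZero F] {h : F[X]} (hh : h ≠ 0) :
    ∃ (j : F[X] →ₐ[F] F⟦X⟧) (δ : Derivation F F⟦X⟧ F⟦X⟧), DiffExtension h j δ := by
  obtain ⟨c, hc⟩ := exists_eval_ne_zero hh
  let j : F[X] →ₐ[F] F⟦X⟧ := (Polynomial.coeToPowerSeries.algHom F).comp (taylorAlgHom c)
  have hj : ∀ f, j f = ((taylor c f : F[X]) : F⟦X⟧) := fun f => by
    simp [j, Polynomial.coeToPowerSeries.algHom_apply]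
  have hu : IsUnit (j h) := by
    rw [PowerSeries.isUnit_iff_constantCoeff, hj]
    simpa [taylor_coeff_zero] using hc
  have hd : ∀ f, PowerSeries.derivative F (j f) = j (derivative f) := fun f => by
    rw [hj, hj, PowerSeries.derivative_coe, taylor_apply, taylor_apply, derivative_comp]
    simp
  refine ⟨j, j h • PowerSeries.derivative F, fun f g e => ?_, fun f => ?_, hu, fun f => ?_⟩
  · rw [hj, hj] at e
    exact taylor_injective c (Polynomial.coe_injective F e)
  · rw [Derivation.smul_apply, hd, map_mul, smul_eq_mul]
  · obtain ⟨w, hw⟩ := hu.exists_right_inv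
    -- An antiderivative of `h⁻¹ f`; its constant term is a division by zero, hence `0`.
    refine ⟨PowerSeries.mk fun n => PowerSeries.coeff (n - 1) (w * j f) / n, ?_⟩
    have : PowerSeries.derivative F
        (PowerSeries.mk fun n => PowerSeries.coeff (n - 1) (w * j f) / n) = w * j f := by
      ext n
      rw [PowerSeries.coeff_derivative, PowerSeries.coeff_mk]
      have : (n : F) + 1 ≠ 0 := by exact_mod_cast n.succ_ne_zero
      push_cast
      field_simp
    rw [Derivation.smul_apply, this, smul_eq_mul, ← mul_assoc, hw, one_mul]

/-- The coefficientwise action of `d/dx` on `F[x][T]`. -/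
abbrev dx : Derivation F F[X][X] F[X][X] := coefDer (derivative' (R := F))

variable {h : F[X]} {j : F[X] →ₐ[F] K} {δ : Derivation F K K} (M : DiffExtension h j δ)

@[simp] theorem mapAlgHom_C (j : F[X] →ₐ[F] K) (a : F[X]) : mapAlgHom j (C a) = C (j a) := by
  simp

@[simp] theorem mapAlgHom_X (j : F[X] →ₐ[F] K) : mapAlgHom j X = X := by simp

include M in
theorem DiffExtension.mapAlgHom_injective : Function.Injective (mapAlgHom j) := by
  intro p q e
  exact Polynomial.map_injective (j : F[X] →+* K) M.injective (by simpa using e)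

include M in
theorem DiffExtension.coefDer_map (p : F[X][X]) :
    coefDer δ (mapAlgHom j p) = mapAlgHom j (C h * dx p) := by
  ext n
  simp [coeff_coefDer, M.map_derivative, derivative', coeff_C_mul]

-- The coefficient `z` may be non-polynomial, but `δ z = b` is polynomial. Each further application
-- of `δ` then produces a factor `h`, which `h * e` absorbs.
include M in
theorem DiffExtension.oreY_pow_apply (n : ℕ) {z : K[X]} {b : F[X][X]}
    (hz : coefDer δ z = mapAlgHom j b) :
    ∃ e, (oreY δ ^ n) z = X ^ n * z + mapAlgHom j (derivative (X ^ n) * b + C h * e) := by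
  induction n with
  | zero => exact ⟨0, by simp⟩
  | succ n ih =>
    obtain ⟨e, he⟩ := ih
    refine ⟨X * e + dx (derivative (X ^ n) * b + C h * e), ?_⟩
    rw [pow_succ', Module.End.mul_apply, he, oreY_apply, map_add (coefDer δ), Derivation.leibniz,
      Derivation.leibniz_pow, coefDer_X, hz, M.coefDer_map, pow_succ (X : F[X][X]), derivative_mul]
    simp only [map_add, map_mul, mapAlgHom_X, mapAlgHom_C, map_pow, derivative_X, smul_eq_mul,
      mul_one]
    ring

include M in
/-- The first two terms of the Leibniz rule for the product of the Ore extension. -/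
theorem DiffExtension.op_map_apply (a : F[X][X]) {z : K[X]} {b : F[X][X]}
    (hz : coefDer δ z = mapAlgHom j b) :
    ∃ e, op δ (mapAlgHom j a) z
      = mapAlgHom j a * z + mapAlgHom j (derivative a * b + C h * e) := by
  induction a using Polynomial.induction_on' with
  | add p q hp hq =>
    obtain ⟨e, he⟩ := hp
    obtain ⟨f, hf⟩ := hq
    refine ⟨e + f, ?_⟩
    rw [map_add, map_add, LinearMap.add_apply, he, hf, derivative_add]
    simp only [map_add, map_mul]
    ring
  | monomial n r =>
    obtain ⟨e, he⟩ := M.oreY_pow_apply n hz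
    refine ⟨C r * e, ?_⟩
    rw [← C_mul_X_pow_eq_monomial, map_mul, mapAlgHom_C, op_C_mul_apply, map_pow, mapAlgHom_X,
      op_X_pow, he, derivative_C_mul]
    simp only [map_add, map_mul, mapAlgHom_C]
    ring

include M in
theorem DiffExtension.oreY_pow_apply_x (n : ℕ) :
    ∃ e : F[X][X], e.degree < n ∧ (oreY δ ^ (n + 1)) (C (j X)) =
      mapAlgHom j (C X * X ^ (n + 1) + C h * (((n + 1 : ℕ) : F[X][X]) * X ^ n + e)) := by
  induction n with
  | zero =>
    refine ⟨0, by simp, ?_⟩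
    rw [zero_add, pow_one, oreY_apply, coefDer_C, M.map_derivative]
    simp only [derivative_X, map_add, map_mul, mapAlgHom_C, mapAlgHom_X, pow_one,
      pow_zero, Nat.cast_one, mul_one, add_zero]
    ring
  | succ n ih =>
    obtain ⟨e, hd, he⟩ := ih
    refine ⟨X * e + dx (C h * (((n + 1 : ℕ) : F[X][X]) * X ^ n + e)), ?_, ?_⟩
    · have h1 : (X * e).degree < ((n + 1 : ℕ) : WithBot ℕ) := by
        rw [degree_lt_iff_coeff_zero] at hd ⊢
        intro m hm
        obtain ⟨m, rfl⟩ : ∃ k, m = k + 1 := ⟨m - 1, by omega⟩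
        rw [coeff_X_mul]; exact hd m (by omega)
      have h2 : (dx (C h * (((n + 1 : ℕ) : F[X][X]) * X ^ n + e))).degree < ((n + 1 : ℕ) : WithBot ℕ) := by
        rw [degree_lt_iff_coeff_zero] at hd ⊢
        intro m hm
        rw [coeff_coefDer, coeff_C_mul, coeff_add, hd m (by omega), ← C_eq_natCast, coeff_C_mul,
          coeff_X_pow, if_neg (by omega)]
        simp
      exact (degree_add_le _ _).trans_lt (max_lt h1 h2)
    · have h1 : dx (C X * X ^ (n + 1) : F[X][X]) = X ^ (n + 1) := by
        rw [C_mul_X_pow_eq_monomial, coefDer_monomial, derivative'_apply, derivative_X,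
          ← X_pow_eq_monomial]
      rw [pow_succ', Module.End.mul_apply, he, oreY_apply, M.coefDer_map,
        map_add dx (C X * X ^ (n + 1)), h1]
      generalize dx (C h * (((n + 1 : ℕ) : F[X][X]) * X ^ n + e)) = w
      simp only [map_add, map_mul, mapAlgHom_X, mapAlgHom_C, map_pow, map_natCast]
      push_cast
      ring

-- The map `g ↦ h⁻¹ [g, x]` is triangular: it sends `r T^(n+1)` to `(n+1) r T^n` plus lower terms.
-- In characteristic zero it can be inverted from the top degree downwards.
include M in
theorem DiffExtension.exists_commutator_x [CharZero F] (s : F[X][X]) :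
    ∃ g, op δ (mapAlgHom j g) (C (j X)) - C (j X) * mapAlgHom j g = mapAlgHom j (C h * s) := by
  suffices ∀ (n : ℕ) (s : F[X][X]), s.degree < n → ∃ g, op δ (mapAlgHom j g) (C (j X)) -
      C (j X) * mapAlgHom j g = mapAlgHom j (C h * s) from
    this (s.natDegree + 1) s (degree_le_natDegree.trans_lt (by exact_mod_cast Nat.lt_succ_self _))
  intro n
  induction n with
  | zero =>
    intro s hs
    obtain rfl : s = 0 := degree_eq_bot.1 (by simpa using hs)
    exact ⟨0, by simp⟩
  | succ n ih =>
    intro s hs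
    obtain ⟨e, hd, he⟩ := M.oreY_pow_apply_x n
    have hn : (n : F) + 1 ≠ 0 := by exact_mod_cast n.succ_ne_zero
    let r : F[X] := C ((n + 1 : F)⁻¹) * s.coeff n
    have hr : ((n + 1 : ℕ) : F[X][X]) * C r = C (s.coeff n) := by
      rw [← C_eq_natCast, ← C_mul, ← C_eq_natCast, ← mul_assoc, ← C_mul]
      push_cast
      rw [mul_inv_cancel₀ hn, C_1, one_mul]
    obtain ⟨g, hg⟩ := ih (s - C r * (((n + 1 : ℕ) : F[X][X]) * X ^ n + e)) <| by
      rw [degree_lt_iff_coeff_zero] at hs hd ⊢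
      intro m hm
      rw [mul_add, ← mul_assoc, mul_comm (C r), hr, coeff_sub, coeff_add, coeff_C_mul,
        coeff_C_mul, hd m hm, coeff_X_pow]
      rcases hm.eq_or_lt with rfl | hm
      · simp
      · rw [hs m hm, if_neg (by omega)]; simp
    refine ⟨g + C r * X ^ (n + 1), ?_⟩
    rw [map_add, map_add, LinearMap.add_apply, map_mul, mapAlgHom_C, op_C_mul_apply, map_pow,
      mapAlgHom_X, op_X_pow, he]
    simp only [map_sub, map_add, map_mul, mapAlgHom_C, map_pow, mapAlgHom_X] at hg ⊢
    linear_combination hg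

include M in
theorem DiffExtension.coeff_commutator_x (p : F[X][X]) (m : ℕ) (hp : p.natDegree ≤ m + 1) :
    (op δ (mapAlgHom j p) (C (j X)) - C (j X) * mapAlgHom j p).coeff m =
      j (h * ((m + 1 : ℕ) * p.coeff (m + 1))) := by
  refine induction_with_natDegree_le (fun p => (op δ (mapAlgHom j p) (C (j X)) -
      C (j X) * mapAlgHom j p).coeff m = j (h * ((m + 1 : ℕ) * p.coeff (m + 1)))) (m + 1)
    (by simp) (fun k r _ hk => ?_) (fun f g hfg hg ihf ihg => ?_) p hp
  · rw [map_mul, mapAlgHom_C, op_C_mul_apply, map_pow, mapAlgHom_X, op_X_pow, mul_left_comm,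
      ← mul_sub, coeff_C_mul, coeff_C_mul]
    cases k with
    | zero => simp [mul_comm, coeff_one]
    | succ k =>
      obtain ⟨e, hd, he⟩ := M.oreY_pow_apply_x k
      rw [degree_lt_iff_coeff_zero] at hd
      rw [he, map_add (mapAlgHom j), map_mul, mapAlgHom_C, map_pow, mapAlgHom_X,
        add_sub_cancel_left]
      have : (mapAlgHom j (C h * (((k + 1 : ℕ) : F[X][X]) * X ^ k + e))).coeff m =
          j (h * (((k + 1 : ℕ) : F[X]) * (X ^ k : F[X][X]).coeff m)) := by
        rw [coe_mapAlgHom, coeff_map, coeff_C_mul, coeff_add, hd m (by omega), ← C_eq_natCast,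
          coeff_C_mul, add_zero]
        rfl
      rw [this, ← map_mul, coeff_X_pow, coeff_X_pow]
      by_cases hmk : m = k
      · subst hmk; simp; ring
      · simp [hmk]
  · rw [map_add, map_add, LinearMap.add_apply, mul_add, add_sub_add_comm, coeff_add, coeff_add,
      ihf, ihg, ← map_add]
    ring_nf

-- The top coefficient of `[c, x]` is `h` times the degree times the leading coefficient of `c`, so
-- the centralizer of `x` is `F[x]`.
include M in
theorem DiffExtension.eq_C_of_commute_x [CharZero F] (hh : h ≠ 0) (c : F[X][X])
    (hc : op δ (mapAlgHom j c) (C (j X)) = C (j X) * mapAlgHom j c) : ∃ s, c = C s := by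
  by_contra hcon
  have hdeg : c.natDegree ≠ 0 := fun h0 => hcon ⟨_, eq_C_of_natDegree_eq_zero h0⟩
  obtain ⟨n, hn⟩ := Nat.exists_eq_succ_of_ne_zero hdeg
  have := M.coeff_commutator_x c n hn.le
  rw [hc, sub_self, coeff_zero, eq_comm, map_eq_zero_iff j M.injective] at this
  have hn' : ((n + 1 : ℕ) : F[X]) ≠ 0 := by exact_mod_cast n.succ_ne_zero
  rcases mul_eq_zero.1 this with h0 | h0
  · exact hh h0
  · have := (mul_eq_zero.1 h0).resolve_left hn'
    rw [← Nat.succ_eq_add_one, ← hn, ← leadingCoeff, leadingCoeff_eq_zero] at this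
    exact hdeg (by simp [this])

end Model

/-! ### Generators of `A_h`, the spanning monomials `f(x) yⁿ`, and classes of derivations. -/

section AlgBasics

variable {F : Type*} [Field F] {h : F[X]}

theorem Alg.induction {P : Alg h → Prop} (hC : ∀ c : F, P (algebraMap F _ c)) (hx : P (x h))
    (hy : P (y h)) (hadd : ∀ a b, P a → P b → P (a + b)) (hmul : ∀ a b, P a → P b → P (a * b))
    (a : Alg h) : P a := by
  obtain ⟨a, rfl⟩ := RingQuot.mkAlgHom_surjective F (Rel h) a
  induction a using FreeAlgebra.induction with
  | grade0 c => simpa using hC c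
  | grade1 i => cases i <;> assumption
  | mul a b ha hb => rw [map_mul]; exact hmul _ _ ha hb
  | add a b ha hb => rw [map_add]; exact hadd _ _ ha hb

theorem Der.map_algebraMap (d : Der F (Alg h)) (c : F) : d.1 (algebraMap F _ c) = 0 := by
  have h1 : d.1 1 = 0 := by simpa using d.leibniz 1 1
  rw [Algebra.algebraMap_eq_smul_one, map_smul, h1, smul_zero]

theorem Der.ext_generators {d e : Der F (Alg h)} (hx : d.1 (x h) = e.1 (x h))
    (hy : d.1 (y h) = e.1 (y h)) : d = e := by
  refine Subtype.ext (LinearMap.ext fun a => ?_)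
  induction a using Alg.induction with
  | hC c => rw [d.map_algebraMap, e.map_algebraMap]
  | hx => exact hx
  | hy => exact hy
  | hadd a b ha hb => rw [map_add, map_add, ha, hb]
  | hmul a b ha hb => rw [d.leibniz, e.leibniz, ha, hb]

theorem y_mul_poly (f : F[X]) :
    y h * poly h f = poly h f * y h + poly h (h * derivative f) := by
  induction f using Polynomial.induction_on with
  | C a => simp [poly, Algebra.commutes]
  | add p q hp hq =>
    simp only [poly, map_add, mul_add, add_mul] at hp hq ⊢
    rw [hp, hq]; abel
  | monomial n a ih =>
    have hc : ∀ f g : F[X], poly h f * poly h g = poly h g * poly h f := fun f g => by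
      simp only [poly, ← map_mul, mul_comm]
    have h1 : poly h (C a * X ^ (n + 1)) = poly h (C a * X ^ n) * x h := by
      simp [poly, pow_succ, mul_assoc]
    have h2 : poly h (h * derivative (C a * X ^ (n + 1))) =
        poly h (h * derivative (C a * X ^ n)) * x h + poly h (C a * X ^ n) * poly h h := by
      have : x h = poly h X := by simp [poly]
      rw [this]
      simp only [poly, ← map_mul, ← map_add]
      congr 1
      rw [pow_succ, ← mul_assoc, derivative_mul (g := X), derivative_X]; ring
    rw [h1, ← mul_assoc, ih, add_mul, mul_assoc, y_mul_x, h2, mul_add, mul_assoc]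
    abel

/-- The map `∑ fₙ Tⁿ ↦ ∑ fₙ(x) yⁿ`. -/
def pbw (h : F[X]) : F[X][X] →ₗ[F] Alg h :=
  lsum fun n => LinearMap.mulRight F (y h ^ n) ∘ₗ (aeval (x h)).toLinearMap

theorem pbw_monomial (n : ℕ) (f : F[X]) : pbw h (monomial n f) = poly h f * y h ^ n := by
  rw [pbw, lsum_apply, sum_monomial_index _ _ (by simp)]
  rfl

theorem pbw_C (f : F[X]) : pbw h (C f) = poly h f := by
  rw [← monomial_zero_left, pbw_monomial, pow_zero, mul_one]

theorem pbw_surjective : Function.Surjective (pbw h) := by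
  -- It suffices that the span of the ordered monomials is a left ideal, since it contains `1`.
  suffices ∀ (a : Alg h) (p : F[X][X]), ∃ r, pbw h r = a * pbw h p from fun a => by
    obtain ⟨r, hr⟩ := this a (C 1)
    exact ⟨r, by rw [hr, pbw_C]; simp [poly]⟩
  intro a
  induction a using Alg.induction with
  | hC c => exact fun p => ⟨c • p, by rw [map_smul, Algebra.smul_def]⟩
  | hx =>
    refine fun p => ⟨C X * p, ?_⟩
    induction p using Polynomial.induction_on' with
    | add p q hp hq => rw [mul_add, map_add, map_add, mul_add, hp, hq]
    | monomial n f => simp [C_mul_monomial, pbw_monomial, poly, mul_assoc]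
  | hy =>
    refine fun p => ⟨X * p + C h * dx p, ?_⟩
    induction p using Polynomial.induction_on' with
    | add p q hp hq =>
      rw [map_add dx, mul_add, mul_add, add_add_add_comm, map_add (pbw h) (X * p + _), hp, hq,
        map_add (pbw h) p, mul_add]
    | monomial n f =>
      rw [coefDer_monomial, C_mul_monomial, X_mul_monomial, map_add, pbw_monomial, pbw_monomial,
        pbw_monomial, ← mul_assoc, y_mul_poly, add_mul, pow_succ', mul_assoc]
      rfl
  | hadd a b ha hb =>
    intro p
    obtain ⟨r, hr⟩ := ha p
    obtain ⟨s, hs⟩ := hb p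
    exact ⟨r + s, by rw [map_add, hr, hs, add_mul]⟩
  | hmul a b ha hb =>
    intro p
    obtain ⟨s, hs⟩ := hb p
    obtain ⟨r, hr⟩ := ha s
    exact ⟨r, by rw [hr, hs, mul_assoc]⟩

theorem exists_derivative_eq {R : Type*} [CommRing R] [CharZero F] [Algebra F R] (a : R[X]) :
    ∃ b, derivative b = a := by
  induction a using Polynomial.induction_on' with
  | add p q hp hq =>
    obtain ⟨b, rfl⟩ := hp
    obtain ⟨c, rfl⟩ := hq
    exact ⟨b + c, derivative_add⟩
  | monomial n r =>
    refine ⟨monomial (n + 1) (algebraMap F R (n + 1 : F)⁻¹ * r), ?_⟩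
    have hn : (n : F) + 1 ≠ 0 := by exact_mod_cast n.succ_ne_zero
    have : algebraMap F R (n + 1 : F)⁻¹ * (n + 1) = 1 := by
      rw [← map_natCast (algebraMap F R), ← map_one (algebraMap F R), ← map_add, ← map_mul,
        inv_mul_cancel₀ hn]
    rw [derivative_monomial, Nat.add_sub_cancel]
    congr 1
    push_cast
    linear_combination r * this

theorem cls_add (d e : Der F (Alg h)) : cls (d + e) = cls d + cls e := rfl

theorem cls_smul (c : F) (d : Der F (Alg h)) : cls (c • d) = c • cls d := rfl

theorem cls_lie (d e : Der F (Alg h)) : cls ⁅d, e⁆ = ⁅cls d, cls e⁆ := rfl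

theorem cls_surjective : Function.Surjective (cls : Der F (Alg h) → HH1 F (Alg h)) :=
  Submodule.Quotient.mk_surjective _

theorem cls_eq_iff {d e : Der F (Alg h)} : cls d = cls e ↔ ∃ a, innerDer a = d - e :=
  Submodule.Quotient.eq _

theorem cls_innerDer (a : Alg h) : cls (innerDer (F := F) a) = 0 :=
  cls_eq_iff.2 ⟨a, (sub_zero _).symm⟩

end AlgBasics

/-! ### The faithful representation of `A_h` and derivations as commutators. -/

section Representation

variable {F K : Type*} [Field F] [CommRing K] [Algebra F K] {h : F[X]} {j : F[X] →ₐ[F] K}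
  {δ : Derivation F K K}

theorem aeval_mulLeft (j : F[X] →ₐ[F] K) (f : F[X]) :
    aeval (LinearMap.mulLeft F (C (j X)) : Module.End F K[X]) f = LinearMap.mulLeft F (C (j f)) := by
  have := aeval_algHom_apply ((Algebra.lmul F K[X]).comp ((CAlgHom (R := F) (A := K)).comp j)) X f
  simpa using! this

variable (M : DiffExtension h j δ)

/-- The representation of `A_h` by left multiplications on the Ore extension `K[T; δ]`. -/
def DiffExtension.rep : Alg h →ₐ[F] Module.End F K[X] :=
  liftAlg (LinearMap.mulLeft F (C (j X))) (oreY δ) (by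
    rw [oreY_mul_mulLeft, aeval_mulLeft, M.map_derivative, derivative_X, mul_one])

theorem DiffExtension.rep_x : M.rep (x h) = LinearMap.mulLeft F (C (j X)) := liftAlg_x _ _ _

theorem DiffExtension.rep_y : M.rep (y h) = oreY δ := liftAlg_y _ _ _

theorem DiffExtension.rep_poly (f : F[X]) : M.rep (poly h f) = LinearMap.mulLeft F (C (j f)) := by
  rw [poly, ← aeval_algHom_apply, M.rep_x, aeval_mulLeft]

theorem DiffExtension.rep_pbw (p : F[X][X]) : M.rep (pbw h p) = op δ (mapAlgHom j p) := by
  induction p using Polynomial.induction_on' with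
  | add p q hp hq => simp only [map_add, hp, hq]
  | monomial n f =>
    rw [pbw_monomial, map_mul, map_pow, M.rep_poly, M.rep_y, ← C_mul_X_pow_eq_monomial, map_mul,
      mapAlgHom_C, map_pow, mapAlgHom_X, op_C_mul, op_X_pow]

/-- Applying `M.rep (pbw h p)` to `1` returns `p`; this gives the PBW theorem for `A_h` along with
faithfulness. -/
theorem DiffExtension.rep_injective : Function.Injective M.rep := by
  rw [injective_iff_map_eq_zero]
  intro a ha
  obtain ⟨p, rfl⟩ := pbw_surjective a
  rw [M.rep_pbw] at ha
  have : mapAlgHom j p = 0 := op_injective δ (by rw [ha, map_zero])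
  rw [(map_eq_zero_iff _ M.mapAlgHom_injective).1 this, map_zero]

/-- `d` is the restriction to `A_h` of the commutator with the operator `e`. -/
def DiffExtension.IsAd (e : Module.End F K[X]) (d : Der F (Alg h)) : Prop :=
  ∀ z, M.rep (d.1 z) = e * M.rep z - M.rep z * e

variable {M}

theorem DiffExtension.IsAd.unique {e : Module.End F K[X]} {d d' : Der F (Alg h)} (hd : M.IsAd e d)
    (hd' : M.IsAd e d') : d = d' :=
  Subtype.ext (LinearMap.ext fun z => M.rep_injective (by rw [hd z, hd' z]))

theorem DiffExtension.IsAd.add {e e' : Module.End F K[X]} {d d' : Der F (Alg h)}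
    (hd : M.IsAd e d) (hd' : M.IsAd e' d') : M.IsAd (e + e') (d + d') := fun z => by
  change M.rep (d.1 z + d'.1 z) = _
  rw [map_add, hd z, hd' z, add_mul, mul_add]; abel

theorem DiffExtension.IsAd.smul {e : Module.End F K[X]} {d : Der F (Alg h)} (c : F)
    (hd : M.IsAd e d) : M.IsAd (c • e) (c • d) := fun z => by
  change M.rep (c • d.1 z) = _
  rw [map_smul, hd z, smul_mul_assoc, mul_smul_comm, smul_sub]

theorem DiffExtension.IsAd.lie {e e' : Module.End F K[X]} {d d' : Der F (Alg h)}
    (hd : M.IsAd e d) (hd' : M.IsAd e' d') : M.IsAd (e * e' - e' * e) ⁅d, d'⁆ := fun z => by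
  change M.rep (d.1 (d'.1 z) - d'.1 (d.1 z)) = _
  rw [map_sub, hd (d'.1 z), hd' (d.1 z), hd z, hd' z]
  simp only [sub_mul, mul_sub, mul_assoc]; abel

variable (M)

theorem DiffExtension.isAd_innerDer (a : Alg h) : M.IsAd (M.rep a) (innerDer a) := fun z => by
  rw [innerDer_apply, map_sub, map_mul, map_mul]

theorem DiffExtension.isAd_of_generators {e : Module.End F K[X]} {d : Der F (Alg h)}
    (hx : M.rep (d.1 (x h)) = e * M.rep (x h) - M.rep (x h) * e)
    (hy : M.rep (d.1 (y h)) = e * M.rep (y h) - M.rep (y h) * e) : M.IsAd e d := fun z => by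
  induction z using Alg.induction with
  | hC c => rw [d.map_algebraMap, map_zero, AlgHom.commutes, Algebra.commutes, sub_self]
  | hx => exact hx
  | hy => exact hy
  | hadd a b ha hb => rw [map_add, map_add, ha, hb, map_add, add_mul, mul_add]; abel
  | hmul a b ha hb =>
    rw [d.leibniz, map_add, map_mul, map_mul, ha, hb, map_mul]
    simp only [sub_mul, mul_sub, mul_assoc]; abel

/-- Faithfulness makes the chosen preimages unique, so linearity and the Leibniz rule descend from
the operator commutator. -/
theorem DiffExtension.exists_isAd {e : Module.End F K[X]}
    (he : ∀ z, ∃ w, M.rep w = e * M.rep z - M.rep z * e) : ∃ d, M.IsAd e d := by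
  choose d hd using he
  refine ⟨⟨⟨⟨d, fun a b => M.rep_injective ?_⟩, fun c a => M.rep_injective ?_⟩,
    fun a b => M.rep_injective ?_⟩, fun z => hd z⟩
  · rw [map_add, hd, hd, hd, map_add, add_mul, mul_add]; abel
  · rw [RingHom.id_apply, map_smul, hd, hd, map_smul, smul_sub, mul_smul_comm, smul_mul_assoc]
  · change M.rep (d (a * b)) = M.rep (d a * b + a * d b)
    rw [map_add, map_mul, map_mul, hd, hd, hd, map_mul]
    simp only [sub_mul, mul_sub, mul_assoc]; abel

theorem DiffExtension.isAd_polyDer {f : F[X]} {g : K} (hg : δ g = j f) :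
    M.IsAd (-LinearMap.mulLeft F (C g)) (polyDer h f) := by
  refine M.isAd_of_generators ?_ ?_
  · rw [polyDer_x, map_zero, M.rep_x, eq_comm, sub_eq_zero]
    ext1 z
    simp only [Module.End.mul_apply, LinearMap.neg_apply, LinearMap.mulLeft_apply]
    ring
  · rw [polyDer_y, M.rep_poly, M.rep_y]
    ext1 z
    simp only [Module.End.mul_apply, LinearMap.neg_apply, LinearMap.sub_apply,
      LinearMap.mulLeft_apply, oreY_apply, map_neg, Derivation.leibniz, coefDer_C, hg, smul_eq_mul]
    ring

end Representation

/-! ### The connection `∇` and the Poisson-type bracket. -/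

section PoissonBracket

variable {F : Type*} [Field F]

/-- The connection `s ↦ π s' - θ s` on `F[x]`, applied coefficientwise. It describes the commutator
of `y` with `q⁻¹ s`. -/
def nabla (π θ : F[X]) : F[X][X] →ₗ[F] F[X][X] :=
  LinearMap.mulLeft F (C π) ∘ₗ dx.toLinearMap - LinearMap.mulLeft F (C θ)

theorem nabla_apply (π θ : F[X]) (a : F[X][X]) : nabla π θ a = C π * dx a - C θ * a := rfl

theorem nabla_C (π θ s : F[X]) : nabla π θ (C s) = C (π * derivative s - θ * s) := by
  rw [nabla_apply, coefDer_C, derivative'_apply]; simp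

theorem nabla_C_mul (π θ r : F[X]) (a : F[X][X]) :
    nabla π θ (C r * a) = C r * nabla π θ a + C (π * derivative r) * a := by
  rw [nabla_apply, nabla_apply, Derivation.leibniz, coefDer_C, derivative'_apply]
  simp only [smul_eq_mul, map_mul]; ring

/-- The bracket on `F[x][T]` induced by the commutator of `q⁻¹ A_h` modulo `A_h`. -/
def poissonBr (π θ : F[X]) (a b : F[X][X]) : F[X][X] :=
  derivative a * nabla π θ b - derivative b * nabla π θ a

end PoissonBracket

/-! ### Commutators with `q⁻¹ a`; throughout, `w` plays the role of `q⁻¹`. -/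

section Fractions

variable {F K : Type*} [Field F] [CommRing K] [Algebra F K] {h : F[X]} {j : F[X] →ₐ[F] K}
  {δ : Derivation F K K} (M : DiffExtension h j δ) {π q θ : F[X]} (H : RadicalFactor h π q θ)
  {w : K} (hw : j q * w = 1)

-- The point is that `δ(q⁻¹) = -h q' / q² = -θ` and `q⁻¹ h = π`, so applying `δ` to a fraction with
-- denominator `q` clears the denominator.
include M H hw in
theorem coefDer_frac (b : F[X][X]) :
    coefDer δ (C w * mapAlgHom j b) = mapAlgHom j (nabla π θ b) := by
  have h1 : δ w = -j θ := by
    have h2 : j q * δ w + w * δ (j q) = 0 := by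
      have := congrArg δ hw
      simpa using this
    rw [M.map_derivative, show h * derivative q = q * q * θ by
      rw [H.eq_mul]; linear_combination -q * H.log_deriv, map_mul, map_mul] at h2
    linear_combination w * h2 - (δ w + j θ * (j q * w + 1)) * hw
  have h3 : w * j h = j π := by
    rw [H.eq_mul, map_mul]; linear_combination j π * hw
  rw [Derivation.leibniz, M.coefDer_map, coefDer_C, h1, nabla_apply]
  simp only [smul_eq_mul, map_sub, map_mul, map_neg, mapAlgHom_C, ← h3]
  ring

include M H hw in
theorem op_frac_apply (a b : F[X][X]) : ∃ e,
    op δ (C w * mapAlgHom j a) (C w * mapAlgHom j b) = C w * C w * mapAlgHom j (a * b) +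
      C w * mapAlgHom j (derivative a * nabla π θ b) + mapAlgHom j e := by
  obtain ⟨e, he⟩ := M.op_map_apply a (coefDer_frac M H hw b)
  have h3 : w * j h = j π := by
    rw [H.eq_mul, map_mul]; linear_combination j π * hw
  refine ⟨C π * e, ?_⟩
  rw [op_C_mul_apply, he]
  simp only [map_add, map_mul, mapAlgHom_C, ← h3]
  ring

-- The symmetric terms `q⁻² a b` cancel, the first-order terms give the bracket, and the later ones
-- carry `q⁻¹ h = π` and so lie in `A_h`.
include M H hw in
theorem commutator_frac (a b : F[X][X]) : ∃ e,
    op δ (C w * mapAlgHom j a) * op δ (C w * mapAlgHom j b) -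
      op δ (C w * mapAlgHom j b) * op δ (C w * mapAlgHom j a) =
    op δ (C w * mapAlgHom j (poissonBr π θ a b)) + op δ (mapAlgHom j e) := by
  obtain ⟨e, he⟩ := op_frac_apply M H hw a b
  obtain ⟨f, hf⟩ := op_frac_apply M H hw b a
  refine ⟨e - f, ?_⟩
  rw [← op_op, ← op_op, ← map_sub (op δ), ← map_add (op δ), he, hf, poissonBr]
  congr 1
  simp only [map_sub, map_mul]
  ring

include hw in
theorem map_eq_frac (b : F[X][X]) : mapAlgHom j b = C w * mapAlgHom j (C q * b) := by
  have : (C (j q) * C w : K[X]) = 1 := by rw [← C_mul, hw, C_1]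
  rw [map_mul, mapAlgHom_C]
  linear_combination -mapAlgHom j b * this

theorem C_dvd_poissonBr {v : F[X]} (hv : v ∣ π * derivative v) (a : F[X][X]) {b : F[X][X]}
    (hb : C v ∣ b) : C v ∣ poissonBr π θ a b := by
  obtain ⟨b, rfl⟩ := hb
  obtain ⟨k, hk⟩ := hv
  refine ⟨derivative a * (nabla π θ b + C k * b) - derivative b * nabla π θ a, ?_⟩
  rw [poissonBr, nabla_C_mul, derivative_C_mul, hk, C_mul]
  ring

-- An element `p` of `A_h` is `q⁻¹ (q p)`, and multiples of `q` form an ideal for the bracket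
-- because `π q' = q θ`; so commutators with `q⁻¹ a` preserve `A_h`.
include M H hw in
theorem exists_isAd_frac (a : F[X][X]) : ∃ d, M.IsAd (op δ (C w * mapAlgHom j a)) d := by
  refine M.exists_isAd fun z => ?_
  obtain ⟨p, rfl⟩ := pbw_surjective z
  obtain ⟨e, he⟩ := commutator_frac M H hw a (C q * p)
  obtain ⟨f, hf⟩ := C_dvd_poissonBr (θ := θ) ⟨θ, H.log_deriv.symm⟩ a (dvd_mul_right (C q) p)
  refine ⟨pbw h (f + e), ?_⟩
  rw [M.rep_pbw, M.rep_pbw, map_eq_frac hw p, he, hf, ← map_eq_frac hw, map_add, map_add]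

/-- The derivation of `A_h` given by the commutator with `q⁻¹ a`. -/
def adFrac : F[X][X] →ₗ[F] Der F (Alg h) where
  toFun a := (exists_isAd_frac M H hw a).choose
  map_add' a b := by
    refine ((exists_isAd_frac M H hw (a + b)).choose_spec).unique ?_
    rw [map_add, mul_add, map_add]
    exact ((exists_isAd_frac M H hw a).choose_spec).add (exists_isAd_frac M H hw b).choose_spec
  map_smul' c a := by
    refine ((exists_isAd_frac M H hw (c • a)).choose_spec).unique ?_
    rw [map_smul, mul_smul_comm, map_smul]
    exact ((exists_isAd_frac M H hw a).choose_spec).smul c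

theorem isAd_adFrac (a : F[X][X]) : M.IsAd (op δ (C w * mapAlgHom j a)) (adFrac M H hw a) :=
  (exists_isAd_frac M H hw a).choose_spec

theorem adFrac_C_mul (p : F[X][X]) : adFrac M H hw (C q * p) = innerDer (pbw h p) := by
  refine (isAd_adFrac M H hw _).unique ?_
  rw [← map_eq_frac hw, ← M.rep_pbw]
  exact M.isAd_innerDer _

theorem adFrac_C (s : F[X]) :
    adFrac M H hw (C s) = polyDer h (-(π * derivative s - θ * s)) := by
  have h1 := coefDer_frac M H hw (C s)
  rw [nabla_C, mapAlgHom_C, mapAlgHom_C, ← C_mul, coefDer_C] at h1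
  have h2 := M.isAd_polyDer (f := -(π * derivative s - θ * s)) (g := -(w * j s))
    (by rw [map_neg, map_neg, C_injective h1])
  refine (isAd_adFrac M H hw _).unique ?_
  convert h2 using 1
  rw [mapAlgHom_C, ← C_mul, op_C]
  ext1 z
  simp [mul_assoc]

theorem lie_adFrac (a b : F[X][X]) :
    ∃ z, ⁅adFrac M H hw a, adFrac M H hw b⁆ = adFrac M H hw (poissonBr π θ a b) + innerDer z := by
  obtain ⟨e, he⟩ := commutator_frac M H hw a b
  refine ⟨pbw h e, ((isAd_adFrac M H hw a).lie (isAd_adFrac M H hw b)).unique ?_⟩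
  rw [he, ← M.rep_pbw]
  exact (isAd_adFrac M H hw _).add (M.isAd_innerDer _)

theorem apply_poly_of_apply_x {d : Der F (Alg h)} (hx : d.1 (x h) = 0) (f : F[X]) :
    d.1 (poly h f) = 0 := by
  induction f using Polynomial.induction_on with
  | C a => simpa [poly] using d.map_algebraMap a
  | add p q hp hq => rw [poly, map_add, map_add]; exact (congrArg₂ _ hp hq).trans (add_zero 0)
  | monomial n a ih =>
    have : poly h (C a * X ^ (n + 1)) = poly h (C a * X ^ n) * x h := by
      simp [poly, pow_succ, mul_assoc]
    rw [this, d.leibniz, ih, hx]; simp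

theorem lie_polyDer_polyDer (f g : F[X]) : ⁅polyDer h f, polyDer h g⁆ = 0 := by
  refine Der.ext_generators ?_ ?_
  · change (polyDer h f).1 ((polyDer h g).1 (x h)) - (polyDer h g).1 ((polyDer h f).1 (x h)) = 0
    rw [polyDer_x, polyDer_x, map_zero, map_zero, sub_self]
  · change (polyDer h f).1 ((polyDer h g).1 (y h)) - (polyDer h g).1 ((polyDer h f).1 (y h)) = 0
    rw [polyDer_y, polyDer_y, apply_poly_of_apply_x (polyDer_x h f),
      apply_poly_of_apply_x (polyDer_x h g), sub_self]

/-- With `δ g = r q`, the factor `q` cancels the denominator in `[-g, q⁻¹ a] = q⁻¹ (a_T r q + h e) =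
a_T r + π e`, an element of `A_h`. -/
theorem lie_polyDer_adFrac (r : F[X]) (a : F[X][X]) :
    ∃ z, ⁅polyDer h (r * q), adFrac M H hw a⁆ = innerDer z := by
  obtain ⟨g, hg⟩ := M.exists_antiderivative (r * q)
  have hg' : coefDer δ (C g) = mapAlgHom j (C (r * q)) := by rw [coefDer_C, hg, mapAlgHom_C]
  obtain ⟨e, he⟩ := M.op_map_apply a hg'
  refine ⟨pbw h (derivative a * C r + C π * e),
    ((M.isAd_polyDer hg).lie (isAd_adFrac M H hw a)).unique ?_⟩
  have hC : -LinearMap.mulLeft F (C g) = op δ (-C g) := by rw [map_neg, op_C]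
  have h3 : w * j h = j π := by
    rw [H.eq_mul, map_mul]; linear_combination j π * hw
  have hw' : (C (j q) * C w : K[X]) = 1 := by rw [← C_mul, hw, C_1]
  have : -LinearMap.mulLeft F (C g) * op δ (C w * mapAlgHom j a) -
      op δ (C w * mapAlgHom j a) * -LinearMap.mulLeft F (C g) =
      M.rep (pbw h (derivative a * C r + C π * e)) := by
    rw [hC, ← op_op, ← op_op, ← map_sub (op δ), M.rep_pbw, map_neg (op δ), LinearMap.neg_apply,
      op_C, map_neg (op δ _), LinearMap.mulLeft_apply, op_C_mul_apply, he]
    congr 1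
    simp only [map_add, map_mul, mapAlgHom_C, ← h3]
    linear_combination mapAlgHom j (derivative a) * C (j r) * hw'
  rw [this]
  exact M.isAd_innerDer _

end Fractions

/-! ### Every derivation is some `D_s` plus the commutator with some `q⁻¹ a`. -/

section Classification

variable {F K : Type*} [Field F] [CommRing K] [Algebra F K] {h : F[X]} {j : F[X] →ₐ[F] K}
  {δ : Derivation F K K} (M : DiffExtension h j δ) {π q θ : F[X]} (H : RadicalFactor h π q θ)
  {w : K} (hw : j q * w = 1)

theorem eq_polyDer_of_apply_x {d : Der F (Alg h)} {s : F[X]} (hx : d.1 (x h) = 0)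
    (hy : d.1 (y h) = poly h s) : d = polyDer h s :=
  Der.ext_generators (by rw [hx, polyDer_x]) (by rw [hy, polyDer_y])

/-- The commutative quotient `A_h / h A_h = (F[x] / h)[T]`. -/
def modH (h : F[X]) : Alg h →ₐ[F] (AdjoinRoot h)[X] :=
  liftAlg (mapAlgHom (AdjoinRoot.mkₐ h) (C X)) X (by
    have := aeval_algHom_apply ((mapAlgHom (AdjoinRoot.mkₐ h)).comp
      (CAlgHom (R := F) (A := F[X]))) X h
    rw [show aeval (mapAlgHom (AdjoinRoot.mkₐ h) (C X)) h = mapAlgHom (AdjoinRoot.mkₐ h) (C h) by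
      simpa using! this, mapAlgHom_C (AdjoinRoot.mkₐ h) h, AdjoinRoot.coe_mkₐ, AdjoinRoot.mk_self,
      C_0, add_zero, mul_comm])

theorem modH_poly (f : F[X]) : modH h (poly h f) = mapAlgHom (AdjoinRoot.mkₐ h) (C f) := by
  have := aeval_algHom_apply ((mapAlgHom (AdjoinRoot.mkₐ h)).comp
    (CAlgHom (R := F) (A := F[X]))) X f
  rw [poly, ← aeval_algHom_apply, modH, liftAlg_x]
  simpa using! this

theorem modH_pbw (p : F[X][X]) : modH h (pbw h p) = mapAlgHom (AdjoinRoot.mkₐ h) p := by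
  induction p using Polynomial.induction_on' with
  | add p q hp hq => simp only [map_add, hp, hq]
  | monomial n f =>
    rw [pbw_monomial, map_mul, map_pow, modH_poly, modH, liftAlg_y,
      ← C_mul_X_pow_eq_monomial, map_mul, map_pow, mapAlgHom_X]

theorem modH_der_poly (d : Der F (Alg h)) (f : F[X]) :
    modH h (d.1 (poly h f)) = mapAlgHom (AdjoinRoot.mkₐ h) (C (derivative f)) * modH h (d.1 (x h)) := by
  induction f using Polynomial.induction_on with
  | C a => simp only [poly, aeval_C, d.map_algebraMap, derivative_C, map_zero, zero_mul]
  | add p q hp hq =>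
    have : poly h (p + q) = poly h p + poly h q := by simp [poly]
    rw [this, map_add, map_add, hp, hq, derivative_add, map_add C, map_add (mapAlgHom _), add_mul]
  | monomial n a ih =>
    have h1 : poly h (C a * X ^ (n + 1)) = poly h (C a * X ^ n) * x h := by
      simp [poly, pow_succ, mul_assoc]
    have h2 : modH h (x h) = mapAlgHom (AdjoinRoot.mkₐ h) (C X) := by rw [modH, liftAlg_x]
    have h3 : derivative (C a * X ^ (n + 1)) = derivative (C a * X ^ n) * X + C a * X ^ n := by
      rw [pow_succ, ← mul_assoc, derivative_mul, derivative_X, mul_one]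
    rw [h1, d.leibniz, map_add, map_mul, map_mul, ih, modH_poly, h2, h3]
    simp only [map_add, map_mul]
    ring

include H in
/-- `d x ∈ π A_h` for every derivation `d`. -/
theorem exists_apply_x_eq (d : Der F (Alg h)) : ∃ s, d.1 (x h) = pbw h (C π * s) := by
  obtain ⟨p, hp⟩ := pbw_surjective (d.1 (x h))
  -- Differentiating `yx = xy + h` and reducing to the commutative quotient leaves only `h' · d x =
  -- 0` modulo `h`.
  have h1 := congrArg (fun z => modH h (d.1 z)) (y_mul_x h)
  simp only [map_add, d.leibniz, map_mul, modH_der_poly, ← hp, modH_pbw] at h1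
  have h2 : mapAlgHom (AdjoinRoot.mkₐ h) (C (derivative h) * p) = 0 := by
    rw [map_mul]; linear_combination -h1
  have h3 : C π ∣ p := by
    rw [C_dvd_iff_dvd_coeff]
    intro n
    refine H.dvd_of_derivative _ (AdjoinRoot.mk_eq_zero.1 ?_)
    have := congrArg (fun p => coeff p n) h2
    rwa [coe_mapAlgHom, coeff_map, coeff_C_mul, coeff_zero] at this
  obtain ⟨s, rfl⟩ := h3
  exact ⟨s, hp.symm⟩

variable [CharZero F]

omit [CharZero F] in
include H in
theorem RadicalFactor.h_ne_zero : h ≠ 0 := by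
  rw [H.eq_mul]; exact mul_ne_zero H.monic.ne_zero H.ne_zero

-- Differentiating `yx = xy + h` when `d x = 0` shows that `d y` commutes with `x`, hence lies in
-- `F[x]`.
include M H in
theorem exists_eq_polyDer {d : Der F (Alg h)} (hx : d.1 (x h) = 0) : ∃ s, d = polyDer h s := by
  obtain ⟨p, hp⟩ := pbw_surjective (d.1 (y h))
  have h1 := congrArg d.1 (y_mul_x h)
  rw [map_add, d.leibniz, d.leibniz, hx, apply_poly_of_apply_x hx, mul_zero, zero_mul, add_zero,
    add_zero, zero_add, ← hp] at h1
  have h2 := congrArg (fun z => M.rep z 1) h1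
  simp only [map_mul, M.rep_pbw, M.rep_x, Module.End.mul_apply, LinearMap.mulLeft_apply, mul_one,
    op_apply_one] at h2
  obtain ⟨s, rfl⟩ := M.eq_C_of_commute_x H.h_ne_zero p h2
  exact ⟨s, eq_polyDer_of_apply_x hx (by rw [← hp, pbw_C])⟩

omit [CharZero F] in
theorem adFrac_x (a : F[X][X]) : M.rep ((adFrac M H hw a).1 (x h)) 1 =
    C w * (op δ (mapAlgHom j a) (C (j X)) - C (j X) * mapAlgHom j a) := by
  rw [isAd_adFrac M H hw a (x h), M.rep_x, LinearMap.sub_apply, Module.End.mul_apply,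
    Module.End.mul_apply, op_apply_one, LinearMap.mulLeft_apply, LinearMap.mulLeft_apply, mul_one,
    op_C_mul_apply]
  ring

theorem eq_C_of_adFrac_x {a : F[X][X]} (ha : (adFrac M H hw a).1 (x h) = 0) : ∃ s, a = C s := by
  have h1 := adFrac_x M H hw a
  rw [ha, map_zero, LinearMap.zero_apply] at h1
  have hw' : (C (j q) * C w : K[X]) = 1 := by rw [← C_mul, hw, C_1]
  refine M.eq_C_of_commute_x H.h_ne_zero a ?_
  linear_combination -C (j q) * h1 -
    (op δ (mapAlgHom j a) (C (j X)) - C (j X) * mapAlgHom j a) * hw'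

/-- If `d x = π s`, choose `a` with `[a, x] = h s`; then `[q⁻¹ a, x] = π s`, and the difference
kills `x`. -/
theorem exists_eq_add (d : Der F (Alg h)) :
    ∃ s a, d = polyDer h s + adFrac M H hw a := by
  obtain ⟨r, hr⟩ := exists_apply_x_eq H d
  obtain ⟨a, ha⟩ := M.exists_commutator_x r
  have h3 : w * j h = j π := by
    rw [H.eq_mul, map_mul]; linear_combination j π * hw
  have h1 : (d - adFrac M H hw a).1 (x h) = 0 := by
    change d.1 (x h) - (adFrac M H hw a).1 (x h) = 0
    refine M.rep_injective ?_
    obtain ⟨p, hp⟩ := pbw_surjective (d.1 (x h) - (adFrac M H hw a).1 (x h))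
    suffices M.rep (pbw h p) 1 = 0 by
      rw [M.rep_pbw, op_apply_one, map_eq_zero_iff _ M.mapAlgHom_injective] at this
      rw [← hp, this, map_zero]
    rw [hp, map_sub, LinearMap.sub_apply, adFrac_x, ha, hr, M.rep_pbw, op_apply_one]
    simp only [map_mul, mapAlgHom_C, ← h3]
    ring
  obtain ⟨s, hs⟩ := exists_eq_polyDer M H h1
  exact ⟨s, a, by rw [← hs, sub_add_cancel]⟩

-- An element whose inner derivation kills `x` is a polynomial `s`, and the inner derivation of `s`
-- is `D_{-h s'}`. Every polynomial is some `s'` in characteristic zero.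
include M in
theorem cls_polyDer_eq_zero_iff (hh : h ≠ 0) (f : F[X]) : cls (polyDer h f) = 0 ↔ h ∣ f := by
  have hin : ∀ s, innerDer (poly h s) = polyDer h (-(h * derivative s)) := fun s => by
    refine eq_polyDer_of_apply_x ?_ ?_
    · rw [innerDer_apply, show x h = poly h X by simp [poly], sub_eq_zero]
      simp only [poly, ← map_mul, mul_comm]
    · rw [innerDer_apply, y_mul_poly]; simp [poly]
  constructor
  · intro hf
    obtain ⟨b, hb⟩ := cls_eq_iff.1 (show cls (polyDer h f) = cls 0 from hf)
    rw [sub_zero] at hb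
    obtain ⟨p, rfl⟩ := pbw_surjective b
    have h1 : (innerDer (F := F) (pbw h p)).1 (x h) = 0 := by rw [hb, polyDer_x]
    have h2 := congrArg (fun z => M.rep z 1) h1
    simp only [innerDer_apply, map_sub, map_mul, M.rep_pbw, M.rep_x, Module.End.mul_apply,
      LinearMap.sub_apply, LinearMap.mulLeft_apply, mul_one, op_apply_one, map_zero,
      LinearMap.zero_apply, sub_eq_zero] at h2
    obtain ⟨s, rfl⟩ := M.eq_C_of_commute_x hh p h2
    rw [pbw_C, hin] at hb
    have h3 := congrArg (fun d : Der F (Alg h) => M.rep (d.1 (y h)) 1) hb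
    simp only [polyDer_y, M.rep_poly, LinearMap.mulLeft_apply, mul_one] at h3
    rw [← M.injective (C_injective h3)]
    exact (dvd_mul_right _ _).neg_right
  · rintro ⟨g, rfl⟩
    obtain ⟨s, hs⟩ := exists_derivative_eq (F := F) (-g)
    have := hin s
    rw [hs, mul_neg, neg_neg] at this
    rw [← this, cls_innerDer]

end Classification

/-! ### The Weyl algebra inside the same model, and the elements `r a_n`. -/

section Weyl

variable {F K : Type*} [Field F] [CommRing K] [Algebra F K] {h : F[X]} {j : F[X] →ₐ[F] K}
  {δ : Derivation F K K} (M : DiffExtension h j δ) {π q θ : F[X]} (H : RadicalFactor h π q θ)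
  {w : K} (hw : j q * w = 1) {k : K} (hk : j h * k = 1)

include M hk in
theorem oreY_mul_mulLeft_inv_comm :
    (oreY δ * LinearMap.mulLeft F (C k)) * LinearMap.mulLeft F (C (j X)) =
      LinearMap.mulLeft F (C (j X)) * (oreY δ * LinearMap.mulLeft F (C k)) +
        aeval (LinearMap.mulLeft F (C (j X)) : Module.End F K[X]) (1 : F[X]) := by
  have hk' : (C (j h) * C k : K[X]) = 1 := by rw [← C_mul, hk, C_1]
  rw [map_one]
  ext1 z
  simp only [Module.End.mul_apply, LinearMap.mulLeft_apply, LinearMap.add_apply, oreY_apply,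
    Derivation.leibniz, coefDer_C, M.map_derivative, derivative_X, mul_one, smul_eq_mul,
    Module.End.one_apply]
  linear_combination z * hk'

/-- The action of the Weyl algebra on the Ore extension `K[T; δ]`, with `y = T h⁻¹`. -/
def weylRep : Alg (1 : F[X]) →ₐ[F] Module.End F K[X] :=
  liftAlg (LinearMap.mulLeft F (C (j X))) (oreY δ * LinearMap.mulLeft F (C k))
    (oreY_mul_mulLeft_inv_comm M hk)

theorem weylRep_y : weylRep M hk (y 1) = oreY δ * LinearMap.mulLeft F (C k) := liftAlg_y _ _ _

theorem weylRep_poly (f : F[X]) : weylRep M hk (poly 1 f) = LinearMap.mulLeft F (C (j f)) := by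
  rw [poly, ← aeval_algHom_apply, weylRep, liftAlg_x, aeval_mulLeft]

theorem weylRep_toWeyl (z : Alg h) : weylRep M hk (toWeyl h z) = M.rep z := by
  have hk' : (C k * C (j h) : K[X]) = 1 := by rw [← C_mul, mul_comm, hk, C_1]
  have : (weylRep M hk).comp (toWeyl h) = M.rep := by
    refine algHom_ext ?_ ?_
    · rw [AlgHom.comp_apply, M.rep_x, toWeyl, liftAlg_x, weylRep, liftAlg_x]
    · rw [AlgHom.comp_apply, M.rep_y, toWeyl, liftAlg_y, map_mul, weylRep_poly, weylRep_y]
      ext1 z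
      simp only [Module.End.mul_apply, LinearMap.mulLeft_apply]
      rw [← mul_assoc, hk', one_mul]
  exact congrArg (fun φ : Alg h →ₐ[F] Module.End F K[X] => φ z) this

theorem natDegree_weylRep_y_pow (n : ℕ) : ((weylRep M hk (y 1) ^ n) 1).natDegree ≤ n ∧
    ((weylRep M hk (y 1) ^ n) 1).coeff n = k ^ n := by
  induction n with
  | zero => simp
  | succ n ih =>
    obtain ⟨h1, h2⟩ := ih
    rw [pow_succ', Module.End.mul_apply]
    generalize (weylRep M hk (y 1) ^ n) 1 = z at h1 h2
    rw [weylRep_y, Module.End.mul_apply, LinearMap.mulLeft_apply, oreY_apply]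
    have h3 : ∀ m, n < m → (coefDer δ (C k * z)).coeff m = 0 := fun m hm => by
      rw [coeff_coefDer, coeff_C_mul, coeff_eq_zero_of_natDegree_lt (h1.trans_lt hm), mul_zero,
        map_zero]
    constructor
    · refine natDegree_le_iff_coeff_eq_zero.2 fun m hm => ?_
      obtain ⟨m, rfl⟩ : ∃ l, m = l + 1 := ⟨m - 1, by omega⟩
      rw [coeff_add, h3 _ (by omega), coeff_X_mul, coeff_C_mul,
        coeff_eq_zero_of_natDegree_lt (by omega), mul_zero, add_zero]
    · rw [coeff_add, h3 _ (by omega), coeff_X_mul, coeff_C_mul, h2, add_zero, pow_succ']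

theorem coeff_weylRep_pbw (p : F[X][X]) (m : ℕ) (hp : p.natDegree ≤ m) :
    (weylRep M hk (pbw 1 p) 1).coeff m = j (p.coeff m) * k ^ m := by
  refine induction_with_natDegree_le (fun p => (weylRep M hk (pbw 1 p) 1).coeff m =
    j (p.coeff m) * k ^ m) m (by simp) (fun n r _ hn => ?_)
    (fun f g hfg hg ihf ihg => ?_) p hp
  · obtain ⟨h1, h2⟩ := natDegree_weylRep_y_pow M hk n
    rw [C_mul_X_pow_eq_monomial, pbw_monomial, map_mul, weylRep_poly, Module.End.mul_apply,
      LinearMap.mulLeft_apply, coeff_C_mul, map_pow, coeff_monomial]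
    rcases hn.eq_or_lt with rfl | hn
    · rw [h2, if_pos rfl]
    · rw [coeff_eq_zero_of_natDegree_lt (h1.trans_lt hn), if_neg hn.ne]; simp
  · rw [map_add, map_add, LinearMap.add_apply, coeff_add, ihf, ihg, coeff_add, map_add, add_mul]

/-- An element of order `m` acts on `1` with coefficient of `T^m` equal to its leading coefficient
times the unit `h^(-m)`. Faithfulness transports identities between operators back to the Weyl
algebra. -/
theorem weylRep_injective : Function.Injective (weylRep M hk) := by
  rw [injective_iff_map_eq_zero]
  intro a ha
  obtain ⟨p, rfl⟩ := pbw_surjective a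
  have h1 := coeff_weylRep_pbw M hk p _ le_rfl
  rw [ha, LinearMap.zero_apply, coeff_zero] at h1
  have h2 : j p.leadingCoeff = 0 := by
    have : j h ^ p.natDegree * k ^ p.natDegree = 1 := by rw [← mul_pow, hk, one_pow]
    rw [← coeff_natDegree]
    linear_combination -j h ^ p.natDegree * h1 - j (p.coeff p.natDegree) * this
  rw [map_eq_zero_iff j M.injective, leadingCoeff_eq_zero] at h2
  rw [h2, map_zero]

include H in
/-- `hⁿ ∂ⁿ = Tⁿ` modulo `q`, where `∂ = T h⁻¹`. -/
theorem exists_mulLeft_mul_weylRep_y_pow (n : ℕ) : ∃ e,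
    LinearMap.mulLeft F (C (j (h ^ n))) * weylRep M hk (y 1) ^ n =
      op δ (mapAlgHom j (X ^ n + C q * e)) := by
  have hk' : (C (j h) * C k : K[X]) = 1 := by rw [← C_mul, hk, C_1]
  have hdk : j h * δ k + k * δ (j h) = 0 := by simpa using congrArg δ hk
  have hd : ∃ η, derivative h = q * η := by
    refine ⟨derivative π + θ, ?_⟩
    rw [H.eq_mul, derivative_mul]; linear_combination -H.log_deriv
  obtain ⟨η, hη⟩ := hd
  induction n with
  | zero => exact ⟨0, by
    rw [mul_zero, add_zero, pow_zero, pow_zero, pow_zero, map_one j, map_one (mapAlgHom j), mul_one,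
      ← op_C δ, C_1]⟩
  | succ n ih =>
    obtain ⟨e, he⟩ := ih
    -- This is `h^(n+1) ∂ = (T - (n+1) h') h^n`. Since `q` divides both `h` and `h'`, multiplying by
    -- the remaining `∂^n` gives `T^(n+1)` modulo `q`.
    have hstep : LinearMap.mulLeft F (C (j (h ^ (n + 1)))) * weylRep M hk (y 1) =
        (oreY δ - LinearMap.mulLeft F (C (j ((n + 1 : ℕ) * derivative h)))) *
          LinearMap.mulLeft F (C (j (h ^ n))) := by
      rw [weylRep_y]
      ext1 z
      simp only [Module.End.mul_apply, LinearMap.mulLeft_apply, LinearMap.sub_apply, oreY_apply,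
        Derivation.leibniz, coefDer_C, smul_eq_mul]
      have e1 : C (j (h ^ (n + 1))) * C k = C (j (h ^ n)) := by
        rw [← C_mul, pow_succ, map_mul j, mul_assoc, hk, mul_one]
      have e2 : C (j (h ^ (n + 1))) * C (δ k) = - C (j (h ^ n * derivative h)) := by
        rw [← C_mul, ← C_neg]
        congr 1
        rw [M.map_derivative, map_mul] at hdk
        rw [pow_succ, map_mul, map_mul]
        linear_combination j (h ^ n) * hdk - j (h ^ n) * j (derivative h) * hk
      have e3 : C (δ (j (h ^ n))) = C (j (n * h ^ n * derivative h)) := by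
        rw [M.map_derivative]
        congr 2
        cases n with
        | zero => simp
        | succ n => rw [derivative_pow]; simp only [Nat.add_sub_cancel, map_natCast]; ring
      rw [e3]
      have e4 : (C (j (n * h ^ n * derivative h)) : K[X]) -
          C (j ((n + 1 : ℕ) * derivative h)) * C (j (h ^ n)) = -C (j (h ^ n * derivative h)) := by
        rw [← C_mul, ← map_mul, ← C_sub, ← map_sub, ← C_neg, ← map_neg]
        congr 2
        push_cast
        ring
      linear_combination (X * z + coefDer δ z) * e1 + z * e2 - z * e4
    refine ⟨X * e + C π * dx (C q * e) - C (((n + 1 : ℕ) : F[X]) * η) * (X ^ n + C q * e), ?_⟩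
    rw [pow_succ' (weylRep M hk (y 1)), ← mul_assoc, hstep, mul_assoc, he, sub_mul, ← op_oreY,
      ← op_C_mul,
      ← map_sub (op δ), oreY_apply, M.coefDer_map, hη]
    have h1 : dx (X ^ n : F[X][X]) = 0 := by
      rw [Derivation.leibniz_pow, coefDer_X]; simp
    rw [map_add dx, h1, zero_add, ← mapAlgHom_X j, ← mapAlgHom_C, ← map_mul (mapAlgHom j),
      ← map_mul (mapAlgHom j), ← map_add (mapAlgHom j), ← map_sub (mapAlgHom j)]
    congr 2
    generalize dx (C q * e) = D
    rw [H.eq_mul]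
    simp only [C_mul]
    ring

-- As `π h^n = q⁻¹ h^(n+1)`, the element `r a_(n+1)` is `q⁻¹ r T^(n+1)` up to an element of `A_h`,
-- which contributes only an inner derivation.
include H hw in
theorem exists_weylRep_eq (r : F[X]) (n : ℕ) : ∃ e,
    weylRep M hk (poly 1 (r * π * h ^ n) * y 1 ^ (n + 1)) =
      op δ (C w * mapAlgHom j (C r * X ^ (n + 1) + C q * e)) := by
  obtain ⟨e, he⟩ := exists_mulLeft_mul_weylRep_y_pow M H hk (n + 1)
  refine ⟨C r * e, ?_⟩
  have h3 : w * j h = j π := by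
    rw [H.eq_mul, map_mul]; linear_combination j π * hw
  have h1 : LinearMap.mulLeft F (C (j (r * π * h ^ n)) : K[X]) =
      LinearMap.mulLeft F (C (w * j r)) * LinearMap.mulLeft F (C (j (h ^ (n + 1)))) := by
    ext1 z
    simp only [Module.End.mul_apply, LinearMap.mulLeft_apply]
    rw [← mul_assoc, ← C_mul, map_mul j (r * π), map_mul j r, ← h3, pow_succ, map_mul j (h ^ n)]
    ring_nf
  rw [map_mul, weylRep_poly, map_pow, h1, mul_assoc, he, ← op_C_mul,
    show C r * X ^ (n + 1) + C q * (C r * e) = C r * (X ^ (n + 1) + C q * e) by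
      rw [mul_add, mul_left_comm], map_mul (mapAlgHom j), mapAlgHom_C, C_mul, mul_assoc]

include M hw in
theorem cls_eq_of_isAdRA (hpi : piPoly h = π) {r : F[X]} {n : ℕ} {d : Der F (Alg h)}
    (hd : IsAdRA h r n d) : cls d = cls (adFrac M H hw (C r * X ^ n)) := by
  obtain ⟨k, hk⟩ := M.isUnit.exists_right_inv
  cases n with
  | zero =>
    -- The division is exact because `h' = q (π' + θ)`.
    have h1 : piPoly h * derivative h / h = derivative π + θ := by
      rw [hpi]
      refine (EuclideanDomain.eq_div_of_mul_eq_left H.h_ne_zero ?_).symm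
      rw [H.eq_mul, derivative_mul]; linear_combination π * H.log_deriv
    have h2 : d = polyDer h (r * (piPoly h * derivative h / h) - derivative (r * piPoly h)) := hd
    rw [h2, h1, hpi, pow_zero, mul_one, adFrac_C, derivative_mul]
    congr 2; ring
  | succ n =>
    obtain ⟨e, he⟩ := exists_weylRep_eq M H hw hk r n
    have h1 : d = adFrac M H hw (C r * X ^ (n + 1) + C q * e) := by
      refine DiffExtension.IsAd.unique (M := M) (fun z => ?_) (isAd_adFrac M H hw _)
      have := congrArg (weylRep M hk) (hd z)
      rwa [hpi, map_sub, map_mul, map_mul _ _ (poly 1 _ * _), he, weylRep_toWeyl,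
        weylRep_toWeyl] at this
    rw [h1, map_add, cls_add, adFrac_C_mul, cls_innerDer, add_zero]

include M hw H in
theorem exists_isAdRA (hpi : piPoly h = π) (r : F[X]) (n : ℕ) : ∃ d, IsAdRA h r n d := by
  obtain ⟨k, hk⟩ := M.isUnit.exists_right_inv
  cases n with
  | zero => exact ⟨_, rfl⟩
  | succ n =>
    obtain ⟨e, he⟩ := exists_weylRep_eq M H hw hk r n
    refine ⟨adFrac M H hw (C r * X ^ (n + 1) + C q * e), fun z => weylRep_injective M hk ?_⟩
    rw [hpi, map_sub, map_mul, map_mul _ _ (poly 1 _ * _), he, weylRep_toWeyl, weylRep_toWeyl]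
    exact isAd_adFrac M H hw _ z

end Weyl

/-! ### Abstract presentation of `HH¹(A_h)`, free of the auxiliary ring `K`. -/

section Presentation

variable {F : Type*} [Field F] {h π q θ : F[X]}

/-- A presentation of `HH¹(A_h)` by the classes of the derivations `D_f` and the classes `Θ a` of
the commutators with `q⁻¹ a`, for `a ∈ A_h = ⨁ F[x] Tⁿ`. -/
structure OuterPresentation (h π q θ : F[X]) (Θ : F[X][X] →ₗ[F] HH1 F (Alg h)) : Prop where
  radicalFactor : RadicalFactor h π q θ
  exists_eq_add : ∀ l, ∃ f a, l = cls (polyDer h f) + Θ a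
  map_C_mul : ∀ a, Θ (C q * a) = 0
  map_C : ∀ s, Θ (C s) = cls (polyDer h (-(π * derivative s - θ * s)))
  lie : ∀ a b, ⁅Θ a, Θ b⁆ = Θ (poissonBr π θ a b)
  cls_polyDer_eq_zero : ∀ f, cls (polyDer h f) = 0 ↔ h ∣ f
  lie_cls_polyDer : ∀ r a, ⁅cls (polyDer h (r * q)), Θ a⁆ = 0
  eq_C_of_cls_polyDer_eq : ∀ f a, cls (polyDer h f) = Θ a → ∃ s b, a = C s + C q * b
  cls_isAdRA : ∀ r n d, IsAdRA h r n d → cls d = Θ (C r * X ^ n)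
  exists_isAdRA : ∀ r n, ∃ d, IsAdRA h r n d

theorem exists_outerPresentation [CharZero F] (H : RadicalFactor h π q θ) (hpi : piPoly h = π) :
    ∃ Θ, OuterPresentation h π q θ Θ := by
  obtain ⟨j, δ, M⟩ := exists_diffExtension H.h_ne_zero
  obtain ⟨k, hk⟩ := M.isUnit.exists_right_inv
  -- The inverse of `q` is obtained as `π h⁻¹`.
  have hw : j q * (j π * k) = 1 := by rw [← hk, H.eq_mul, map_mul]; ring
  let Θ : F[X][X] →ₗ[F] HH1 F (Alg h) :=
    { toFun := fun a => cls (adFrac M H hw a)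
      map_add' := fun a b => by rw [map_add, cls_add]
      map_smul' := fun c a => by rw [map_smul, cls_smul, RingHom.id_apply] }
  refine ⟨Θ, H, fun l => ?_, fun a => ?_, fun s => ?_, fun a b => ?_, 
    cls_polyDer_eq_zero_iff M H.h_ne_zero, fun r a => ?_, fun f a hfa => ?_,
    fun r n d hd => cls_eq_of_isAdRA M H hw hpi hd, exists_isAdRA M H hw hpi⟩
  · obtain ⟨d, rfl⟩ := cls_surjective l
    obtain ⟨s, a, rfl⟩ := exists_eq_add M H hw d
    exact ⟨s, a, rfl⟩
  · change cls (adFrac M H hw (C q * a)) = 0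
    rw [adFrac_C_mul, cls_innerDer]
  · change cls (adFrac M H hw (C s)) = _
    rw [adFrac_C]
  · obtain ⟨z, hz⟩ := lie_adFrac M H hw a b
    change ⁅cls _, cls _⁆ = cls _
    rw [← cls_lie, hz, cls_add, cls_innerDer, add_zero]
  · obtain ⟨z, hz⟩ := lie_polyDer_adFrac M H hw r a
    change ⁅cls _, cls _⁆ = _
    rw [← cls_lie, hz, cls_innerDer]
  · obtain ⟨z, hz⟩ := cls_eq_iff.1 (show cls (polyDer h f) = cls (adFrac M H hw a) from hfa)
    obtain ⟨p, rfl⟩ := pbw_surjective z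
    have h1 : adFrac M H hw (a + C q * p) = polyDer h f := by
      rw [map_add, adFrac_C_mul, hz]; abel
    obtain ⟨s, hs⟩ := eq_C_of_adFrac_x M H hw (a := a + C q * p) (by rw [h1, polyDer_x])
    exact ⟨s, -p, by rw [← hs]; ring⟩

end Presentation

/-! ### The center and the derived algebra. -/

section CenterAndDerived

variable {F : Type*} [Field F] {h π q θ : F[X]}

theorem RadicalFactor.dvd_connection_iff (H : RadicalFactor h π q θ) (s : F[X]) :
    q ∣ π * derivative s - θ * s ↔ q ∣ s := by
  refine ⟨H.dvd_of_dvd s, ?_⟩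
  rintro ⟨r, rfl⟩
  refine ⟨π * derivative r, ?_⟩
  rw [derivative_mul]; linear_combination -r * H.log_deriv

/-- The composite of `∇` with reduction modulo `q` has the same kernel as reduction itself, so the
two images have the same finite dimension and `∇` is onto modulo `q`. -/
theorem RadicalFactor.exists_connection_eq (H : RadicalFactor h π q θ) (f : F[X]) :
    ∃ s r, f = π * derivative s - θ * s + r * q := by
  let m : F[X] →ₗ[F] AdjoinRoot q := (AdjoinRoot.mkₐ q).toLinearMap
  let g : F[X] →ₗ[F] AdjoinRoot q := m ∘ₗ
    (LinearMap.mulLeft F π ∘ₗ (derivative : F[X] →ₗ[F] F[X]) - LinearMap.mulLeft F θ)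
  have hker : LinearMap.ker g = LinearMap.ker m := by
    ext s
    rw [LinearMap.mem_ker, LinearMap.mem_ker]
    exact AdjoinRoot.mk_eq_zero.trans ((H.dvd_connection_iff s).trans AdjoinRoot.mk_eq_zero.symm)
  have hm : LinearMap.range m = ⊤ := LinearMap.range_eq_top.2 AdjoinRoot.mk_surjective
  have : Module.Finite F (AdjoinRoot q) := (AdjoinRoot.powerBasis H.ne_zero).finite
  have hg : LinearMap.range g = ⊤ := by
    refine Submodule.eq_top_of_finrank_eq ?_
    rw [← g.quotKerEquivRange.finrank_eq, hker, m.quotKerEquivRange.finrank_eq, hm, finrank_top]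
  obtain ⟨s, hs⟩ := LinearMap.range_eq_top.1 hg (AdjoinRoot.mk q f)
  obtain ⟨r, hr⟩ := AdjoinRoot.mk_eq_mk.1 (show AdjoinRoot.mk q f =
    AdjoinRoot.mk q (π * derivative s - θ * s) from hs.symm)
  exact ⟨s, r, by linear_combination hr⟩

variable {Θ : F[X][X] →ₗ[F] HH1 F (Alg h)} (P : OuterPresentation h π q θ Θ)

theorem cls_polyDer_add (f g : F[X]) :
    cls (polyDer h (f + g)) = cls (polyDer h f) + cls (polyDer h g) := by
  rw [← cls_add]
  congr 1
  refine Der.ext_generators ?_ ?_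
  · change _ = (polyDer h f).1 _ + (polyDer h g).1 _
    rw [polyDer_x, polyDer_x, polyDer_x, add_zero]
  · change _ = (polyDer h f).1 _ + (polyDer h g).1 _
    rw [polyDer_y, polyDer_y, polyDer_y]; simp [poly]

theorem cls_polyDer_smul (c : F) (f : F[X]) :
    cls (polyDer h (c • f)) = c • cls (polyDer h f) := by
  rw [← cls_smul]
  congr 1
  refine Der.ext_generators ?_ ?_
  · change _ = c • (polyDer h f).1 _
    rw [polyDer_x, polyDer_x, smul_zero]
  · change _ = c • (polyDer h f).1 _
    rw [polyDer_y, polyDer_y]; simp [poly]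

/-- The linear map `r ↦ D_{r q}`. -/
def centralMap (h q : F[X]) : F[X] →ₗ[F] HH1 F (Alg h) where
  toFun r := cls (polyDer h (r * q))
  map_add' r s := by rw [add_mul, cls_polyDer_add]
  map_smul' c r := by rw [smul_mul_assoc, cls_polyDer_smul, RingHom.id_apply]

theorem centralMap_apply (r : F[X]) : centralMap h q r = cls (polyDer h (r * q)) := rfl

namespace OuterPresentation

include P

theorem centralMap_eq_zero_iff (r : F[X]) : centralMap h q r = 0 ↔ π ∣ r := by
  rw [centralMap_apply, P.cls_polyDer_eq_zero, P.radicalFactor.eq_mul,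
    mul_dvd_mul_iff_right P.radicalFactor.ne_zero]

/-- The equality forces `a` to be some `s ∈ F[x]` modulo `q`, and then `h` divides `r q + ∇s`. Hence
`q ∣ ∇s`, and `q ∣ s` by injectivity of `∇` modulo `q`. This gives both the kernel of `Θ` and the
directness of the sum. -/
theorem eq_zero_of_centralMap_eq {r : F[X]} {a : F[X][X]} (hra : centralMap h q r = Θ a) :
    C q ∣ a ∧ centralMap h q r = 0 := by
  obtain ⟨s, b, rfl⟩ := P.eq_C_of_cls_polyDer_eq _ _ hra
  have hs : q ∣ s := by
    have h1 : cls (polyDer h (r * q + (π * derivative s - θ * s))) = 0 := by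
      have h2 := cls_polyDer_add (h := h) (π * derivative s - θ * s)
        (-(π * derivative s - θ * s))
      rw [add_neg_cancel, (P.cls_polyDer_eq_zero 0).2 (dvd_zero _)] at h2
      rw [cls_polyDer_add, ← centralMap_apply, hra, map_add, P.map_C_mul, add_zero, P.map_C,
        add_comm, ← h2]
    have h2 := (P.cls_polyDer_eq_zero _).1 h1
    rw [← P.radicalFactor.dvd_connection_iff]
    exact (dvd_add_right (dvd_mul_left q r)).1
      ((Dvd.intro_left _ P.radicalFactor.eq_mul.symm).trans h2)
  have hd : C q ∣ C s + C q * b := dvd_add (_root_.map_dvd C hs) (dvd_mul_right _ _)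
  refine ⟨hd, ?_⟩
  obtain ⟨e, he⟩ := hd
  rw [hra, he, P.map_C_mul]

theorem map_eq_zero_iff (a : F[X][X]) : Θ a = 0 ↔ C q ∣ a := by
  constructor
  · intro ha
    exact (P.eq_zero_of_centralMap_eq (r := 0) (by rw [ha, map_zero])).1
  · rintro ⟨b, rfl⟩
    exact P.map_C_mul b

theorem exists_eq_centralMap_add (l : HH1 F (Alg h)) : ∃ r a, l = centralMap h q r + Θ a := by
  obtain ⟨f, a, rfl⟩ := P.exists_eq_add l
  obtain ⟨s, r, hf⟩ := P.radicalFactor.exists_connection_eq f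
  refine ⟨r, a + C (-s), ?_⟩
  rw [map_add, P.map_C, centralMap_apply, hf, add_comm (_ - _) (r * q), cls_polyDer_add,
    derivative_neg, mul_neg, mul_neg, neg_sub_neg, neg_sub, add_comm (Θ a), add_assoc]

theorem lie_centralMap (r : F[X]) (l : HH1 F (Alg h)) : ⁅centralMap h q r, l⁆ = 0 := by
  obtain ⟨s, a, rfl⟩ := P.exists_eq_centralMap_add l
  rw [lie_add, centralMap_apply, centralMap_apply, P.lie_cls_polyDer, ← cls_lie,
    lie_polyDer_polyDer, add_zero]
  rfl

theorem lie_eq (r s : F[X]) (a b : F[X][X]) :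
    ⁅centralMap h q r + Θ a, centralMap h q s + Θ b⁆ = Θ (poissonBr π θ a b) := by
  rw [add_lie, P.lie_centralMap, zero_add, lie_add, ← lie_skew, P.lie_centralMap, neg_zero,
    zero_add, P.lie]

end OuterPresentation

theorem poissonBr_one (π θ : F[X]) (a : F[X][X]) : poissonBr π θ 1 a = C θ * derivative a := by
  rw [poissonBr, ← C_1, nabla_C, derivative_C, derivative_one, mul_zero, zero_sub, mul_one, C_neg]
  ring

theorem poissonBr_X_C (π θ s : F[X]) :
    poissonBr π θ X (C s) = C (π * derivative s - θ * s) := by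
  rw [poissonBr, nabla_C, derivative_X, derivative_C, one_mul, zero_mul, sub_zero]

/-- Since `{1, b} = θ b_T`, it is enough to integrate `θ⁻¹ a` in `T`, with the inverse of `θ` taken
modulo `q`. Perfectness of the derived algebra rests on this. -/
theorem exists_poissonBr_one_eq [CharZero F] {θ q : F[X]} (hc : IsCoprime θ q) (π : F[X])
    (a : F[X][X]) : ∃ b e, poissonBr π θ 1 b = a + C q * e := by
  obtain ⟨ψ, φ, hψ⟩ := hc
  obtain ⟨b, hb⟩ := exists_derivative_eq (F := F) (C ψ * a)
  refine ⟨b, -C φ * a, ?_⟩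
  have : C ψ * C θ + C φ * C q = (1 : F[X][X]) := by
    rw [← C_mul, ← C_mul, ← C_add, hψ, C_1]
  rw [poissonBr_one, hb]
  linear_combination a * this

namespace OuterPresentation

variable [CharZero F]
include P

theorem mem_derivedIdeal_iff (l : HH1 F (Alg h)) :
    l ∈ derivedIdeal F (HH1 F (Alg h)) ↔ ∃ a, l = Θ a := by
  constructor
  · intro hl
    rw [← LieSubmodule.mem_toSubmodule, LieSubmodule.lieIdeal_oper_eq_linear_span'] at hl
    induction hl using Submodule.span_induction with
    | mem l hl =>
      obtain ⟨x, -, z, -, rfl⟩ := hl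
      obtain ⟨r, a, rfl⟩ := P.exists_eq_centralMap_add x
      obtain ⟨s, b, rfl⟩ := P.exists_eq_centralMap_add z
      exact ⟨_, P.lie_eq r s a b⟩
    | zero => exact ⟨0, (map_zero _).symm⟩
    | add x z _ _ hx hz =>
      obtain ⟨a, rfl⟩ := hx
      obtain ⟨b, rfl⟩ := hz
      exact ⟨a + b, (map_add _ _ _).symm⟩
    | smul c x _ hx =>
      obtain ⟨a, rfl⟩ := hx
      exact ⟨c • a, (map_smul _ _ _).symm⟩
  · rintro ⟨a, rfl⟩
    obtain ⟨b, e, hb⟩ := exists_poissonBr_one_eq P.radicalFactor.coprime π a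
    have : Θ a = ⁅Θ 1, Θ b⁆ := by rw [P.lie, hb, map_add, P.map_C_mul, add_zero]
    rw [this]
    exact LieSubmodule.lie_mem_lie (LieSubmodule.mem_top _) (LieSubmodule.mem_top _)

/-- Commuting with `Θ 1` makes `a` constant in `T` modulo `q`; commuting with `Θ X` then says that
`∇` kills this constant modulo `q`, so the constant vanishes there. -/
theorem mem_center_iff (l : HH1 F (Alg h)) :
    l ∈ LieAlgebra.center F (HH1 F (Alg h)) ↔ ∃ r, l = centralMap h q r := by
  rw [LieModule.mem_maxTrivSubmodule]
  constructor
  · intro hl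
    obtain ⟨r, a, rfl⟩ := P.exists_eq_centralMap_add l
    have key : ∀ b, C q ∣ poissonBr π θ b a := fun b => by
      rw [← P.map_eq_zero_iff, ← P.lie_eq 0 r]; exact hl _
    obtain ⟨ψ, φ, hψ⟩ := P.radicalFactor.coprime
    have hψ' : C ψ * C θ + C φ * C q = (1 : F[X][X]) := by
      rw [← C_mul, ← C_mul, ← C_add, hψ, C_1]
    have h1 : C q ∣ derivative a := by
      obtain ⟨e, he⟩ := key 1
      rw [poissonBr_one] at he
      exact ⟨C ψ * e + C φ * derivative a, by linear_combination C ψ * he - derivative a * hψ'⟩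
    obtain ⟨s, b, rfl⟩ : ∃ s b, a = C s + C q * b := by
      obtain ⟨e, he⟩ := h1
      obtain ⟨b, rfl⟩ := exists_derivative_eq (F := F) e
      have : derivative (a - C q * b) = 0 := by
        rw [derivative_sub, derivative_C_mul, he, sub_self]
      exact ⟨_, b, by
        rw [← eq_C_of_natDegree_eq_zero (derivative_eq_zero.1 this)]; ring⟩
    have h2 := hl (Θ X)
    rw [map_add, P.map_C_mul, add_zero] at h2 ⊢
    have h3 := P.lie_eq 0 r X (C s)
    rw [map_zero, zero_add, h2, poissonBr_X_C, eq_comm, P.map_eq_zero_iff,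
      C_dvd_iff_dvd_coeff] at h3
    have h4 := h3 0
    rw [coeff_C_zero, P.radicalFactor.dvd_connection_iff] at h4
    exact ⟨r, by rw [(P.map_eq_zero_iff _).2 (_root_.map_dvd C h4), add_zero]⟩
  · rintro ⟨r, rfl⟩ x
    rw [← lie_skew, P.lie_centralMap, neg_zero]

theorem isCompl_center_derivedIdeal : IsCompl (LieAlgebra.center F (HH1 F (Alg h)))
    (derivedIdeal F (HH1 F (Alg h))) := by
  constructor
  · rw [disjoint_iff, LieSubmodule.eq_bot_iff]
    rintro l hl
    rw [LieSubmodule.mem_inf, P.mem_center_iff, P.mem_derivedIdeal_iff] at hl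
    obtain ⟨⟨r, rfl⟩, a, ha⟩ := hl
    exact (P.eq_zero_of_centralMap_eq ha).2
  · rw [codisjoint_iff, eq_top_iff]
    intro l _
    obtain ⟨r, a, rfl⟩ := P.exists_eq_centralMap_add l
    rw [LieSubmodule.mem_sup]
    exact ⟨_, (P.mem_center_iff _).2 ⟨r, rfl⟩, _, (P.mem_derivedIdeal_iff _).2 ⟨a, rfl⟩, rfl⟩

omit [CharZero F] in
theorem exists_centralMap_eq_of_degree_lt (r : F[X]) :
    ∃ s : F[X], s.degree < π.degree ∧ centralMap h q r = centralMap h q s := by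
  refine ⟨r %ₘ π, degree_modByMonic_lt _ P.radicalFactor.monic, ?_⟩
  rw [← sub_eq_zero, ← map_sub, P.centralMap_eq_zero_iff]
  exact ⟨r /ₘ π, by linear_combination -modByMonic_add_div r π⟩

theorem coe_center_eq : (LieAlgebra.center F (HH1 F (Alg h)) : Set (HH1 F (Alg h))) =
    {z | ∃ r : F[X], r.degree < π.degree ∧ z = cls (polyDer h (r * q))} := by
  ext l
  rw [SetLike.mem_coe, P.mem_center_iff]
  constructor
  · rintro ⟨r, rfl⟩
    obtain ⟨s, hs, h1⟩ := P.exists_centralMap_eq_of_degree_lt r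
    exact ⟨s, hs, h1⟩
  · rintro ⟨r, -, rfl⟩
    exact ⟨r, rfl⟩

theorem rank_center :
    Module.rank F (LieAlgebra.center F (HH1 F (Alg h))) = π.natDegree := by
  let g : degreeLT F π.natDegree →ₗ[F] HH1 F (Alg h) :=
    centralMap h q ∘ₗ (degreeLT F π.natDegree).subtype
  have hdeg : π.degree = π.natDegree := degree_eq_natDegree P.radicalFactor.monic.ne_zero
  have hinj : Function.Injective g := by
    rw [injective_iff_map_eq_zero]
    rintro ⟨r, hr⟩ h0
    rw [mem_degreeLT, ← hdeg] at hr
    exact Subtype.ext (eq_zero_of_dvd_of_degree_lt ((P.centralMap_eq_zero_iff r).1 h0) hr)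
  have hrange : LinearMap.range g = (LieAlgebra.center F (HH1 F (Alg h))).toSubmodule := by
    ext l
    rw [LieSubmodule.mem_toSubmodule, P.mem_center_iff]
    constructor
    · rintro ⟨r, rfl⟩
      exact ⟨r.1, rfl⟩
    · rintro ⟨r, rfl⟩
      obtain ⟨s, hs, h1⟩ := P.exists_centralMap_eq_of_degree_lt r
      exact ⟨⟨s, by rwa [mem_degreeLT, ← hdeg]⟩, h1.symm⟩
  have e1 := (LinearEquiv.ofInjective g hinj).rank_eq
  rw [hrange] at e1
  refine e1.symm.trans ?_
  rw [(degreeLTEquiv F π.natDegree).rank_eq]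
  simp

end OuterPresentation

end CenterAndDerived

/-! ### Ideals and nilpotency in the Lie algebra `F[x, T] / (q)`. -/

section Bracket

variable {F 𝔤 : Type*} [Field F] [LieRing 𝔤] [LieAlgebra F 𝔤]

/-- A presentation of the Lie algebra `𝔤` as `F[x][T] / q` with the bracket `poissonBr π θ`. -/
structure BracketPresentation (π q θ : F[X]) (Φ : F[X][X] →ₗ[F] 𝔤) : Prop where
  surjective : Function.Surjective Φ
  eq_zero_iff : ∀ a, Φ a = 0 ↔ C q ∣ a
  lie : ∀ a b, ⁅Φ a, Φ b⁆ = Φ (poissonBr π θ a b)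
  coprime : IsCoprime θ q

theorem nabla_dvd {π θ v : F[X]} (hv : v ∣ π) (k : ℕ) (a : F[X][X]) :
    C (v ^ k) ∣ nabla π θ (C (v ^ k) * a) := by
  rw [nabla_C_mul]
  refine dvd_add (dvd_mul_right _ _) (Dvd.dvd.mul_right (_root_.map_dvd C ?_) _)
  obtain ⟨e, rfl⟩ := hv
  cases k with
  | zero => simp
  | succ k =>
    rw [derivative_pow_succ, pow_succ]
    exact ⟨e * C ((k : F) + 1) * derivative v, by ring⟩

theorem C_dvd_poissonBr_pow {π θ v : F[X]} (hv : v ∣ π) (i k : ℕ) (a b : F[X][X]) :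
    C (v ^ (i + k)) ∣ poissonBr π θ (C (v ^ i) * a) (C (v ^ k) * b) := by
  rw [poissonBr, derivative_C_mul, derivative_C_mul, pow_add, C_mul]
  refine dvd_sub (mul_dvd_mul (dvd_mul_right _ _) (nabla_dvd hv k b)) ?_
  rw [mul_comm (C (v ^ i))]
  exact mul_dvd_mul (dvd_mul_right _ _) (nabla_dvd hv i a)

namespace BracketPresentation

variable {π q θ : F[X]} {Φ : F[X][X] →ₗ[F] 𝔤} (P : BracketPresentation π q θ Φ) {v : F[X]}

/-- The ideal of the classes of multiples of `v`. -/
def idealOf (hv : v ∣ π) : LieIdeal F 𝔤 where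
  carrier := {z | ∃ a, z = Φ (C v * a)}
  add_mem' := by
    rintro _ _ ⟨a, rfl⟩ ⟨b, rfl⟩
    exact ⟨a + b, by rw [mul_add, map_add]⟩
  zero_mem' := ⟨0, by simp⟩
  smul_mem' := by
    rintro c _ ⟨a, rfl⟩
    exact ⟨c • a, by rw [mul_smul_comm, map_smul]⟩
  lie_mem := by
    rintro z _ ⟨a, rfl⟩
    obtain ⟨b, rfl⟩ := P.surjective z
    rw [P.lie]
    obtain ⟨e, he⟩ := C_dvd_poissonBr (θ := θ) (Dvd.dvd.mul_right hv (derivative v)) b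
      (dvd_mul_right (C v) a)
    exact ⟨e, by rw [he]⟩

theorem mem_idealOf {hv : v ∣ π} {z : 𝔤} : z ∈ P.idealOf hv ↔ ∃ a, z = Φ (C v * a) := Iff.rfl

include P in
theorem map_eq_of_dvd_sub {a b : F[X][X]} (hd : C q ∣ a - b) : Φ a = Φ b := by
  rw [← sub_eq_zero, ← map_sub, P.eq_zero_iff]; exact hd

theorem map_mem_idealOf_iff {hv : v ∣ π} (hvq : v ∣ q) (a : F[X][X]) :
    Φ a ∈ P.idealOf hv ↔ C v ∣ a := by
  constructor
  · rintro ⟨b, hb⟩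
    rw [← sub_eq_zero, ← map_sub, P.eq_zero_iff] at hb
    exact (dvd_sub_left (dvd_mul_right _ _)).1 ((_root_.map_dvd C hvq).trans hb)
  · rintro ⟨b, rfl⟩
    exact ⟨b, rfl⟩

theorem idealOf_eq_bot_iff {hv : v ∣ π} : P.idealOf hv = ⊥ ↔ q ∣ v := by
  rw [LieSubmodule.eq_bot_iff]
  constructor
  · intro h0
    have := h0 (Φ (C v * 1)) ⟨1, rfl⟩
    rw [mul_one, P.eq_zero_iff, C_dvd_iff_dvd_coeff] at this
    simpa using this 0
  · rintro hd _ ⟨a, rfl⟩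
    rw [P.eq_zero_iff]
    exact Dvd.dvd.mul_right (_root_.map_dvd C hd) _

/-- The powers of `v` form a filtration compatible with the bracket, so term `k` of the lower
central series consists of classes of multiples of `v^(k+1)`. -/
theorem isNilpotent_idealOf (hv : v ∣ π) {n : ℕ} (hn : q ∣ v ^ n) :
    LieRing.IsNilpotent (P.idealOf hv) := by
  have key : ∀ k, ∀ z ∈ LieModule.lowerCentralSeries F (P.idealOf hv) (P.idealOf hv) k,
      ∃ a, z.1 = Φ (C (v ^ (k + 1)) * a) := by
    intro k
    induction k with
    | zero =>
      intro z _
      simpa using P.mem_idealOf.1 z.2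
    | succ k ih =>
      intro z hz
      rw [LieModule.lowerCentralSeries_succ, ← LieSubmodule.mem_toSubmodule,
        LieSubmodule.lieIdeal_oper_eq_linear_span'] at hz
      induction hz using Submodule.span_induction with
      | mem z hz =>
        obtain ⟨a, -, b, hb, rfl⟩ := hz
        obtain ⟨c, hc⟩ := ih b hb
        obtain ⟨d, hd⟩ := P.mem_idealOf.1 a.2
        obtain ⟨e, he⟩ := C_dvd_poissonBr_pow (θ := θ) hv 1 (k + 1) d c
        rw [pow_one, add_comm 1] at he
        exact ⟨e, by change ⁅a.1, b.1⁆ = _; rw [hc, hd, P.lie, he]⟩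
      | zero => exact ⟨0, by simp⟩
      | add x z _ _ hx hz =>
        obtain ⟨a, ha⟩ := hx
        obtain ⟨b, hb⟩ := hz
        exact ⟨a + b, by rw [mul_add, map_add, ← ha, ← hb]; rfl⟩
      | smul c x _ hx =>
        obtain ⟨a, ha⟩ := hx
        exact ⟨c • a, by rw [mul_smul_comm, map_smul, ← ha]; rfl⟩
  refine (LieModule.isNilpotent_iff F _ _).2 ⟨n, ?_⟩
  rw [LieSubmodule.eq_bot_iff]
  intro z hz
  obtain ⟨a, ha⟩ := key n z hz
  refine Subtype.ext (ha.trans ((P.eq_zero_iff _).2 (Dvd.dvd.mul_right (_root_.map_dvd C ?_) _)))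
  exact hn.trans (pow_dvd_pow v n.le_succ)

variable [CharZero F]

-- Bracketing with `1` replaces `a` by `θ a_T`, of lower degree and still not divisible by `v`,
-- until `v ∣ a_T`. At that stage `a` is a constant modulo `v`.
include P in
theorem exists_C_mem_of_mem (hvq : v ∣ q) (I : LieIdeal F 𝔤) (n : ℕ) (a : F[X][X])
    (hn : a.natDegree ≤ n) (ha : Φ a ∈ I) (hva : ¬ C v ∣ a) :
    ∃ r e, ¬ v ∣ r ∧ Φ (C r + C v * e) ∈ I := by
  induction n generalizing a with
  | zero =>
    rw [eq_C_of_natDegree_eq_zero (Nat.le_zero.1 hn)] at ha hva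
    exact ⟨a.coeff 0, 0, fun hd => hva (_root_.map_dvd C hd), by simpa using ha⟩
  | succ n ih =>
    by_cases hd : C v ∣ derivative a
    · obtain ⟨e, he⟩ := hd
      obtain ⟨b, rfl⟩ := exists_derivative_eq (F := F) e
      have h0 : derivative (a - C v * b) = 0 := by
        rw [derivative_sub, derivative_C_mul, he, sub_self]
      have h1 := eq_C_of_natDegree_eq_zero (derivative_eq_zero.1 h0)
      generalize (a - C v * b).coeff 0 = r at h1
      obtain rfl : a = C r + C v * b := by rw [← h1]; ring
      exact ⟨r, b, fun hr => hva (dvd_add (_root_.map_dvd C hr) (dvd_mul_right _ _)), ha⟩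
    · refine ih (poissonBr π θ 1 a) ?_ ?_ ?_
      · rw [poissonBr_one]
        exact (natDegree_C_mul_le _ _).trans ((natDegree_derivative_le a).trans (by omega))
      · rw [← P.lie]
        exact lie_mem_right F 𝔤 I _ _ ha
      · rw [poissonBr_one]
        intro h1
        obtain ⟨ψ, φ, hψ⟩ := P.coprime.of_isCoprime_of_dvd_right hvq
        have hψ' : C ψ * C θ + C φ * C v = (1 : F[X][X]) := by
          rw [← C_mul, ← C_mul, ← C_add, hψ, C_1]
        obtain ⟨e, he⟩ := h1
        exact hd ⟨C ψ * e + C φ * derivative a, by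
          linear_combination C ψ * he - derivative a * hψ'⟩

-- Modulo `v` the connection is multiplication by `-θ`, and the derivative in `T` of `r + v e`
-- vanishes, so only one term survives.
omit [CharZero F] in
theorem exists_poissonBr_eq_mod (hv : v ∣ π) (r s : F[X]) (e a b : F[X][X]) :
    ∃ e', poissonBr π θ (C r + C v * e) (C s * a + C v * b) =
      C θ * derivative a * (C r * C s) + C v * e' := by
  obtain ⟨ρ, rfl⟩ := hv
  refine ⟨derivative e * nabla (v * ρ) θ (C s * a + C v * b) - derivative b *
    nabla (v * ρ) θ (C r + C v * e) -
      C s * derivative a * (C ρ * dx (C r + C v * e) - C θ * e), ?_⟩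
  have h1 : nabla (v * ρ) θ (C r + C v * e) = C v * (C ρ * dx (C r + C v * e) - C θ * e) -
      C θ * C r := by
    rw [nabla_apply, C_mul]; ring
  rw [poissonBr]
  generalize nabla (v * ρ) θ (C s * a + C v * b) = n1
  generalize nabla (v * ρ) θ (C r + C v * e) = n2 at h1 ⊢
  generalize C ρ * dx (C r + C v * e) - C θ * e = n3 at h1 ⊢
  simp only [derivative_add, derivative_C_mul, derivative_C, zero_add]
  linear_combination -(C s * derivative a) * h1

theorem mul_add_eq_of_bezout {R : Type*} [CommRing R] {ψ θ φ v : R} (hψ : ψ * θ + φ * v = 1)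
    (b d e : R) : θ * (ψ * b) * d + v * e = d * b + v * (e - φ * d * b) := by
  linear_combination d * b * hψ

include P in
/-- If `I` contains `r` modulo `v`, the terms of its lower central series contain all multiples of
powers of `r` modulo `v`. -/
theorem exists_mem_lowerCentralSeries (hv : v ∣ π) (hvq : v ∣ q) (I : LieIdeal F 𝔤) {r : F[X]}
    {e : F[X][X]} (hr : Φ (C r + C v * e) ∈ I) (k : ℕ) (b : F[X][X]) :
    ∃ z ∈ LieModule.lowerCentralSeries F I I k, ∃ e', z.1 = Φ (C (r ^ (k + 1)) * b + C v * e') := by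
  obtain ⟨ψ, φ, hψ⟩ := P.coprime.of_isCoprime_of_dvd_right hvq
  have hψ' : C ψ * C θ + C φ * C v = (1 : F[X][X]) := by
    rw [← C_mul, ← C_mul, ← C_add, hψ, C_1]
  induction k generalizing b with
  | zero =>
    -- As `ψ` inverts `θ` modulo `v`, the choice `c_T = ψ b` makes `θ c_T` congruent to the
    -- prescribed `b`.
    obtain ⟨c, hc⟩ := exists_derivative_eq (F := F) (C ψ * b)
    obtain ⟨e', he'⟩ := exists_poissonBr_eq_mod (θ := θ) hv r 1 e c 0
    refine ⟨⟨⁅Φ (C r + C v * e), Φ (C 1 * c + C v * 0)⁆, lie_mem_left F 𝔤 I _ _ hr⟩, ?_,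
      e' - C φ * (C r * C 1) * b, ?_⟩
    · rw [LieModule.lowerCentralSeries_zero]; exact LieSubmodule.mem_top _
    · change ⁅_, _⁆ = _
      rw [P.lie, he', hc, mul_add_eq_of_bezout hψ', ← C_mul, mul_one, zero_add, pow_one]
  | succ k ih =>
    obtain ⟨c, hc⟩ := exists_derivative_eq (F := F) (C ψ * b)
    obtain ⟨z, hz, e1, he1⟩ := ih c
    obtain ⟨e', he'⟩ := exists_poissonBr_eq_mod (θ := θ) hv r (r ^ (k + 1)) e c e1
    refine ⟨⁅(⟨_, hr⟩ : I), z⁆, ?_, e' - C φ * (C r * C (r ^ (k + 1))) * b, ?_⟩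
    · rw [LieModule.lowerCentralSeries_succ]
      exact LieSubmodule.lie_mem_lie (LieSubmodule.mem_top _) hz
    · change ⁅Φ (C r + C v * e), z.1⁆ = _
      rw [he1, P.lie, he', hc, mul_add_eq_of_bezout hψ', ← C_mul, ← pow_succ']

/-- Otherwise `I` contains a constant `r` modulo `v` with `v ∤ r`, and term `k` of its lower central
series contains `r^(k+1)` modulo `v`. Nilpotency gives `v ∣ r^(k+1)`, and `v` is radical. -/
theorem le_idealOf_of_isNilpotent (hv : v ∣ π) (hvq : v ∣ q) (hrad : IsRadical v)
    (I : LieIdeal F 𝔤) (hI : LieRing.IsNilpotent I) : I ≤ P.idealOf hv := by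
  intro z hz
  obtain ⟨a, rfl⟩ := P.surjective z
  rw [P.map_mem_idealOf_iff hvq]
  by_contra hva
  obtain ⟨r, e, hvr, hr⟩ := P.exists_C_mem_of_mem hvq I _ a le_rfl hz hva
  obtain ⟨k, hk⟩ := (LieModule.isNilpotent_iff F I I).1 hI
  obtain ⟨z, hz, e', he'⟩ := P.exists_mem_lowerCentralSeries hv hvq I hr k 1
  rw [hk, LieSubmodule.mem_bot] at hz
  have h1 : C q ∣ C (r ^ (k + 1)) * 1 + C v * e' := by
    rw [← P.eq_zero_iff, ← he', hz]; rfl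
  have h2 := (dvd_add_left (dvd_mul_right _ _)).1 ((_root_.map_dvd C hvq).trans h1)
  rw [mul_one, C_dvd_iff_dvd_coeff] at h2
  exact hvr (hrad (k + 1) r (by have := h2 0; rwa [coeff_C_zero] at this))

-- The algebra is perfect, so its lower central series is constant.
include P in
theorem not_isNilpotent (hq : ¬ IsUnit q) : ¬ LieRing.IsNilpotent 𝔤 := by
  intro hnil
  obtain ⟨k, hk⟩ := (LieModule.isNilpotent_iff F 𝔤 𝔤).1 hnil
  have htop : ∀ k, LieModule.lowerCentralSeries F 𝔤 𝔤 k = ⊤ := by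
    intro k
    induction k with
    | zero => exact LieModule.lowerCentralSeries_zero ..
    | succ k ih =>
      rw [LieModule.lowerCentralSeries_succ, ih, eq_top_iff]
      intro z _
      obtain ⟨a, rfl⟩ := P.surjective z
      obtain ⟨b, e, hb⟩ := exists_poissonBr_one_eq P.coprime π a
      have : Φ a = ⁅Φ 1, Φ b⁆ := by
        rw [P.lie, hb, map_add, (P.eq_zero_iff _).2 (dvd_mul_right _ _), add_zero]
      rw [this]
      exact LieSubmodule.lie_mem_lie (LieSubmodule.mem_top _) (LieSubmodule.mem_top _)
  have h1 : Φ 1 ∈ LieModule.lowerCentralSeries F 𝔤 𝔤 k := by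
    rw [htop]; exact LieSubmodule.mem_top _
  rw [hk, LieSubmodule.mem_bot, P.eq_zero_iff, C_dvd_iff_dvd_coeff] at h1
  exact hq (isUnit_of_dvd_one (by simpa using h1 0))

end BracketPresentation

theorem not_hasTrivialRadical_of_isNilpotent {I : LieIdeal F 𝔤} (hI : LieRing.IsNilpotent I)
    (hne : I ≠ ⊥) : ¬ LieAlgebra.HasTrivialRadical F 𝔤 := by
  intro hrad
  have : LieAlgebra.IsSolvable I := inferInstance
  have hle : I ≤ LieAlgebra.radical F 𝔤 := le_sSup this
  rw [hrad.radical_eq_bot, le_bot_iff] at hle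
  exact hne hle

end Bracket

/-! ### Transfer of the bracket presentation to `[L, L]`. -/

section Derived

variable {F : Type*} [Field F] [CharZero F] {h π q θ : F[X]} {Θ : F[X][X] →ₗ[F] HH1 F (Alg h)}

/-- The map `Θ` into the derived algebra of `HH¹(A_h)`. -/
def OuterPresentation.toDerived (P : OuterPresentation h π q θ Θ) :
    F[X][X] →ₗ[F] derivedIdeal F (HH1 F (Alg h)) where
  toFun a := ⟨Θ a, (P.mem_derivedIdeal_iff _).2 ⟨a, rfl⟩⟩
  map_add' a b := Subtype.ext (map_add Θ a b)
  map_smul' c a := Subtype.ext (map_smul Θ c a)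

theorem OuterPresentation.bracketPresentation (P : OuterPresentation h π q θ Θ) :
    BracketPresentation π q θ P.toDerived where
  surjective z := by
    obtain ⟨a, ha⟩ := (P.mem_derivedIdeal_iff _).1 z.2
    exact ⟨a, Subtype.ext ha.symm⟩
  eq_zero_iff a := by
    rw [← P.map_eq_zero_iff]
    exact Subtype.ext_iff
  lie a b := Subtype.ext (P.lie a b)
  coprime := P.radicalFactor.coprime

theorem OuterPresentation.map_idealOf (P : OuterPresentation h π q θ Θ) {v : F[X]} (hv : v ∣ π) :
    (P.bracketPresentation.idealOf hv).toSubmodule.map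
      (derivedIdeal F (HH1 F (Alg h))).toSubmodule.subtype = adSpan h v := by
  apply le_antisymm
  · rintro _ ⟨z, ⟨a, rfl⟩, rfl⟩
    change Θ (C v * a) ∈ adSpan h v
    induction a using Polynomial.induction_on' with
    | add p q hp hq => rw [mul_add, map_add]; exact add_mem hp hq
    | monomial n r =>
      obtain ⟨d, hd⟩ := P.exists_isAdRA (v * r) n
      refine Submodule.subset_span ⟨v * r, n, d, dvd_mul_right _ _, hd, ?_⟩
      rw [P.cls_isAdRA _ _ _ hd, ← C_mul_X_pow_eq_monomial, C_mul, mul_assoc]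
  · refine Submodule.span_le.2 ?_
    rintro _ ⟨_, n, d, ⟨r, rfl⟩, hd, rfl⟩
    refine ⟨P.toDerived (C v * (C r * X ^ n)), ⟨_, rfl⟩, ?_⟩
    rw [P.cls_isAdRA _ _ _ hd, C_mul, mul_assoc]
    rfl

theorem OuterPresentation.derivedIdeal_eq_bot (P : OuterPresentation h π q θ Θ) (hq : IsUnit q) :
    derivedIdeal F (HH1 F (Alg h)) = ⊥ := by
  rw [LieSubmodule.eq_bot_iff]
  intro l hl
  obtain ⟨a, rfl⟩ := (P.mem_derivedIdeal_iff l).1 hl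
  exact (P.map_eq_zero_iff a).2 ((isUnit_C.2 hq).dvd)

end Derived

/-! ### The algebras `(F[x] / u) ⊗ W` as vector fields in `T`, and their simplicity. -/

section WittExt

variable {F : Type*} [Field F] (u : F[X])

/-- The bilinear map `(a, w) ↦ a ⊗ w` into `(F[x] / u) ⊗ W`. -/
def wittTmul : (F[X] ⧸ Ideal.span {u}) →ₗ[F] Witt F →ₗ[F] WittExt u :=
  TensorProduct.mk F (F[X] ⧸ Ideal.span {u}) (Witt F)

theorem lie_wittTmul (a b : F[X] ⧸ Ideal.span {u}) (v w : Witt F) :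
    ⁅wittTmul u a v, wittTmul u b w⁆ = wittTmul u (a * b) ⁅v, w⁆ := rfl

/-- The map `∑ fₙ Tⁿ ↦ ∑ fₙ ⊗ w_{n-1}`. -/
def toWittExt : F[X][X] →ₗ[F] WittExt u :=
  lsum fun n => (wittTmul u).flip (Witt.w F (n - 1)) ∘ₗ
    (Ideal.Quotient.mkₐ F (Ideal.span {u})).toLinearMap

theorem toWittExt_monomial (n : ℕ) (f : F[X]) :
    toWittExt u (monomial n f) = wittTmul u (Ideal.Quotient.mk _ f) (Witt.w F (n - 1)) := by
  rw [toWittExt, lsum_apply, sum_monomial_index _ _ (by simp)]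
  rfl

theorem toWittExt_mul_derivative (m n : ℕ) (f g : F[X]) :
    toWittExt u (monomial m f * derivative (monomial n g)) =
      (n : F) • wittTmul u (Ideal.Quotient.mk _ (f * g)) (Witt.w F (m + n - 2)) := by
  rw [derivative_monomial, monomial_mul_monomial, toWittExt_monomial,
    show f * (g * (n : F[X])) = (n : F) • (f * g) by
      rw [Algebra.smul_def, map_natCast]; ring,
    show Ideal.Quotient.mk (Ideal.span {u}) ((n : F) • (f * g)) =
      (n : F) • Ideal.Quotient.mk (Ideal.span {u}) (f * g) from
        map_smul (Ideal.Quotient.mkₐ F (Ideal.span {u})) _ _, map_smul, LinearMap.smul_apply]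
  -- The case `n = 0` is separate because the exponent `n - 1` is truncated; there the factor `n`
  -- kills both sides.
  cases n with
  | zero => simp
  | succ n =>
    congr 3
    push_cast
    ring

theorem lie_toWittExt (a b : F[X][X]) :
    ⁅toWittExt u a, toWittExt u b⁆ = toWittExt u (a * derivative b - derivative a * b) := by
  induction a using Polynomial.induction_on' with
  | add p q hp hq =>
    rw [map_add, add_lie, hp, hq, ← map_add, derivative_add]
    congr 1; ring
  | monomial m f =>
    induction b using Polynomial.induction_on' with
    | add p q hp hq =>
      rw [map_add, lie_add, hp, hq, ← map_add, derivative_add]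
      congr 1; ring
    | monomial n g =>
      rw [map_sub, mul_comm (derivative _), toWittExt_mul_derivative, toWittExt_mul_derivative,
        toWittExt_monomial, toWittExt_monomial, lie_wittTmul, Witt.lie_w (by omega) (by omega),
        map_smul, mul_comm g f, add_comm (n : ℤ) m, ← sub_smul, ← map_mul]
      congr 2
      · push_cast; ring
      · congr 1; ring

theorem toWittExt_C_mul (b : F[X][X]) : toWittExt u (C u * b) = 0 := by
  induction b using Polynomial.induction_on' with
  | add p q hp hq => rw [mul_add, map_add, hp, hq, add_zero]
  | monomial n f =>
    rw [C_mul_monomial, toWittExt_monomial, Ideal.Quotient.eq_zero_iff_mem.2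
      (Ideal.mem_span_singleton.2 (dvd_mul_right u f)), map_zero, LinearMap.zero_apply]

/-- The coordinates of an element of `(F[x] / u) ⊗ W` in the basis of `W`. -/
def wittCoord : WittExt u ≃ₗ[F] ({i : ℤ // -1 ≤ i} →₀ F[X] ⧸ Ideal.span {u}) :=
  TensorProduct.equivFinsuppOfBasisRight (Witt.basis F)

theorem wittCoord_toWittExt (a : F[X][X]) (n : ℕ) :
    wittCoord u (toWittExt u a) ⟨n - 1, by omega⟩ = Ideal.Quotient.mk _ (a.coeff n) := by
  induction a using Polynomial.induction_on' with
  | add p q hp hq => rw [map_add, map_add, Finsupp.add_apply, hp, hq, coeff_add, map_add]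
  | monomial m f =>
    have hw : Witt.w F ((m : ℤ) - 1) = Witt.basis F ⟨m - 1, by omega⟩ := by
      rw [Witt.basis_eq_w]
    rw [toWittExt_monomial, hw]
    refine (TensorProduct.equivFinsuppOfBasisRight_apply_tmul_apply _ _ _ _).trans ?_
    rw [Module.Basis.repr_self, coeff_monomial, Finsupp.single_apply]
    by_cases hmn : m = n
    · subst hmn; simp
    · rw [if_neg hmn, if_neg (by simp only [Subtype.mk.injEq]; omega)]; simp

theorem toWittExt_eq_zero_iff (a : F[X][X]) : toWittExt u a = 0 ↔ C u ∣ a := by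
  constructor
  · intro ha
    rw [C_dvd_iff_dvd_coeff]
    intro n
    rw [← Ideal.mem_span_singleton, ← Ideal.Quotient.eq_zero_iff_mem, ← wittCoord_toWittExt, ha]
    simp
  · rintro ⟨b, rfl⟩
    exact toWittExt_C_mul u b

theorem toWittExt_surjective : Function.Surjective (toWittExt u) := by
  rw [← LinearMap.range_eq_top, eq_top_iff]
  rintro z -
  induction z using TensorProduct.induction_on with
  | zero => exact zero_mem _
  | add x z hx hz => exact add_mem hx hz
  | tmul a w =>
    change wittTmul u a w ∈ _
    obtain ⟨f, rfl⟩ := Ideal.Quotient.mk_surjective a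
    have hw := (Witt.basis F).mem_span w
    induction hw using Submodule.span_induction with
    | mem w hw =>
      obtain ⟨i, rfl⟩ := hw
      refine ⟨monomial (i.1 + 1).toNat f, ?_⟩
      have := i.2
      rw [toWittExt_monomial, Witt.basis_eq_w]
      congr 2
      omega
    | zero => rw [map_zero]; exact zero_mem _
    | add x z _ _ hx hz => rw [map_add]; exact add_mem hx hz
    | smul c x _ hx => rw [map_smul]; exact Submodule.smul_mem _ c hx

/-- With `π = 0` and `θ = 1` the connection is `-1` and the bracket is that of vector fields, so the
arguments about ideals apply here too. -/
theorem bracketPresentation_toWittExt : BracketPresentation 0 u 1 (toWittExt u) where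
  surjective := toWittExt_surjective u
  eq_zero_iff := toWittExt_eq_zero_iff u
  lie a b := by
    have h1 : a * derivative b - derivative a * b = poissonBr 0 1 a b := by
      rw [poissonBr, nabla_apply, nabla_apply, C_0, C_1, zero_mul, zero_mul]
      ring
    rw [lie_toWittExt, h1]
  coprime := isCoprime_one_left

variable {u}

/-- A nonzero ideal contains a constant `r` not divisible by `u`, which is invertible modulo `u`;
the brackets `[r, b] = r b_T` then exhaust the algebra. -/
theorem isSimple_wittExt [CharZero F] (hu : Irreducible u) :
    LieAlgebra.IsSimple F (WittExt u) where
  eq_bot_or_eq_top I := by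
    have P := bracketPresentation_toWittExt u
    refine or_iff_not_imp_left.2 fun hI => ?_
    obtain ⟨z, hz, hz0⟩ : ∃ z ∈ I, z ≠ 0 := by
      by_contra! hcon
      exact hI ((LieSubmodule.eq_bot_iff _).2 hcon)
    obtain ⟨a, rfl⟩ := P.surjective z
    rw [Ne, P.eq_zero_iff] at hz0
    obtain ⟨r, e, hr, hre⟩ := P.exists_C_mem_of_mem dvd_rfl I _ a le_rfl hz hz0
    rw [map_add, toWittExt_C_mul, add_zero] at hre
    obtain ⟨φ, s, hs⟩ := hu.coprime_iff_not_dvd.2 hr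
    rw [eq_top_iff]
    intro z _
    obtain ⟨c, rfl⟩ := P.surjective z
    obtain ⟨b, hb⟩ := exists_derivative_eq (F := F) (C s * c)
    have h1 := lie_mem_left F _ I _ (toWittExt u b) hre
    rw [lie_toWittExt, derivative_C, zero_mul, sub_zero, hb] at h1
    have h2 : toWittExt u c = toWittExt u (C r * (C s * c)) := by
      refine P.map_eq_of_dvd_sub ⟨C φ * c, ?_⟩
      have : C φ * C u + C s * C r = (1 : F[X][X]) := by
        rw [← C_mul, ← C_mul, ← C_add, hs, C_1]
      linear_combination -c * this
    rwa [h2]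
  non_abelian hab := by
    have h1 := hab.trivial (toWittExt u 1) (toWittExt u X)
    rw [lie_toWittExt, derivative_X, derivative_one, zero_mul, sub_zero, mul_one,
      toWittExt_eq_zero_iff, C_dvd_iff_dvd_coeff] at h1
    exact hu.not_isUnit (isUnit_of_dvd_one (by simpa using h1 0))

end WittExt

/-! ### The quotient by the multiples of `v` as a sum of Witt algebras. -/

section Quotient

variable {F 𝔤 : Type*} [Field F] [LieRing 𝔤] [LieAlgebra F 𝔤] {π q θ : F[X]}
  {Φ : F[X][X] →ₗ[F] 𝔤} (P : BracketPresentation π q θ Φ) {v : F[X]}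
  {ι : Type*} [Fintype ι] [DecidableEq ι] {u : ι → F[X]}

include P in
theorem BracketPresentation.exists_linearMap {E : Type*} [AddCommGroup E] [Module F E]
    (g : F[X][X] →ₗ[F] E) (hg : ∀ a, C q ∣ a → g a = 0) : ∃ f : 𝔤 →ₗ[F] E, ∀ a, f (Φ a) = g a := by
  refine ⟨(LinearMap.ker Φ).liftQ g (fun a ha => hg a ((P.eq_zero_iff a).1 (LinearMap.mem_ker.1 ha))) ∘ₗ
    (Φ.quotKerEquivOfSurjective P.surjective).symm.toLinearMap, fun a => ?_⟩
  have : (Φ.quotKerEquivOfSurjective P.surjective).symm (Φ a) = (LinearMap.ker Φ).mkQ a := by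
    rw [LinearEquiv.symm_apply_eq]; rfl
  rw [LinearMap.comp_apply, LinearEquiv.coe_coe, this]
  exact Submodule.liftQ_apply _ _ _

/-- Modulo `u` the bracket is `θ (a b_T - a_T b)`, and multiplication by `θ`, which is constant in
`T`, turns it into the bracket of vector fields. -/
theorem toWittExt_mul_poissonBr {u : F[X]} (hu : u ∣ π) (a b : F[X][X]) :
    toWittExt u (C θ * poissonBr π θ a b) = ⁅toWittExt u (C θ * a), toWittExt u (C θ * b)⁆ := by
  obtain ⟨ρ, rfl⟩ := hu
  rw [lie_toWittExt]
  refine (bracketPresentation_toWittExt u).map_eq_of_dvd_sub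
    ⟨C θ * C ρ * (derivative a * dx b - derivative b * dx a), ?_⟩
  rw [poissonBr, nabla_apply, nabla_apply, C_mul, derivative_C_mul, derivative_C_mul]
  ring

/-- The map `a ↦ (θ a)ᵢ` into the direct sum of the algebras `(F[x] / uᵢ) ⊗ W`. -/
def toSumWittExt (θ : F[X]) (u : ι → F[X]) : F[X][X] →ₗ[F] ⨁ i, WittExt (u i) :=
  (DirectSum.linearEquivFunOnFintype F ι fun i => WittExt (u i)).symm.toLinearMap ∘ₗ
    LinearMap.pi fun i => toWittExt (u i) ∘ₗ LinearMap.mulLeft F (C θ)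

omit [DecidableEq ι] in
theorem toSumWittExt_apply (a : F[X][X]) (i : ι) :
    toSumWittExt θ u a i = toWittExt (u i) (C θ * a) := rfl

theorem exists_crt (hu : Pairwise fun i j => IsCoprime (u i) (u j)) (b : ι → F[X][X]) :
    ∃ c, ∀ i, C (u i) ∣ c - b i := by
  have h1 : ∀ i, ∃ e : F[X], u i ∣ e - 1 ∧ ∀ j, j ≠ i → u j ∣ e := fun i => by
    obtain ⟨x, z, hxz⟩ : IsCoprime (u i) (∏ j ∈ Finset.univ.erase i, u j) :=
      IsCoprime.prod_right fun j hj => hu (Finset.ne_of_mem_erase hj).symm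
    refine ⟨z * ∏ j ∈ Finset.univ.erase i, u j, ⟨-x, by linear_combination hxz⟩, fun j hj => ?_⟩
    exact Dvd.dvd.mul_left (Finset.dvd_prod_of_mem _ (Finset.mem_erase.2 ⟨hj, Finset.mem_univ j⟩)) _
  choose e he1 he2 using h1
  refine ⟨∑ i, C (e i) * b i, fun i => ?_⟩
  rw [← Finset.add_sum_erase _ _ (Finset.mem_univ i), add_sub_right_comm]
  refine dvd_add ?_ (Finset.dvd_sum fun j hj =>
    Dvd.dvd.mul_right (_root_.map_dvd C (he2 j i (Finset.ne_of_mem_erase hj).symm)) _)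
  obtain ⟨k, hk⟩ := he1 i
  refine ⟨C k * b i, ?_⟩
  rw [← mul_assoc, ← C_mul, ← hk, C_sub, C_1]; ring

/-- The map is `a ↦ θ a` in every component. As `θ` is invertible modulo `v`, its kernel is the
multiples of `v`, and surjectivity is the Chinese remainder theorem. -/
theorem BracketPresentation.exists_lieHom (hu : Pairwise fun i j => IsCoprime (u i) (u j))
    (hvu : v = ∏ i, u i) (hv : v ∣ π) (hvq : v ∣ q) :
    ∃ f : 𝔤 →ₗ⁅F⁆ ⨁ i, WittExt (u i), Function.Surjective f ∧ ∀ z, f z = 0 ↔ z ∈ P.idealOf hv := by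
  have hdvd : ∀ i, u i ∣ v := fun i => hvu ▸ Finset.dvd_prod_of_mem u (Finset.mem_univ i)
  obtain ⟨ψ, φ, hψ⟩ := P.coprime.of_isCoprime_of_dvd_right hvq
  have hψ' : C ψ * C θ + C φ * C v = (1 : F[X][X]) := by
    rw [← C_mul, ← C_mul, ← C_add, hψ, C_1]
  have hzero : ∀ a, toSumWittExt θ u a = 0 ↔ C v ∣ a := by
    intro a
    constructor
    · intro ha
      have h1 : ∀ i, C (u i) ∣ C θ * a := fun i => by
        rw [← toWittExt_eq_zero_iff, ← toSumWittExt_apply, ha]; rfl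
      have h2 : C v ∣ C θ * a := by
        rw [C_dvd_iff_dvd_coeff]
        intro n
        rw [hvu]
        exact Finset.prod_dvd_of_coprime (fun i _ j _ hij => hu hij)
          fun i _ => (C_dvd_iff_dvd_coeff _ _).1 (h1 i) n
      obtain ⟨e, he⟩ := h2
      exact ⟨C ψ * e + C φ * a, by linear_combination C ψ * he - a * hψ'⟩
    · intro ha
      refine DFinsupp.ext fun i => ?_
      exact (toSumWittExt_apply a i).trans ((toWittExt_eq_zero_iff _ _).2
        (((_root_.map_dvd C (hdvd i)).trans ha).mul_left _))
  obtain ⟨f, hf⟩ := P.exists_linearMap (toSumWittExt θ u)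
    fun a ha => (hzero a).2 ((_root_.map_dvd C hvq).trans ha)
  refine ⟨{ f with
    map_lie' := ?_ }, fun z => ?_, fun z => ?_⟩
  · intro x z
    obtain ⟨a, rfl⟩ := P.surjective x
    obtain ⟨b, rfl⟩ := P.surjective z
    change f ⁅Φ a, Φ b⁆ = ⁅f (Φ a), f (Φ b)⁆
    rw [P.lie, hf, hf, hf]
    refine DFinsupp.ext fun i => ?_
    have h1 := DirectSum.bracket_apply (L := fun i => WittExt (u i)) (toSumWittExt θ u a)
      (toSumWittExt θ u b) i
    rw [h1, toSumWittExt_apply, toSumWittExt_apply, toSumWittExt_apply,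
      toWittExt_mul_poissonBr ((hdvd i).trans hv)]
  · choose b hb using fun i => toWittExt_surjective (u i) (z i)
    obtain ⟨c, hc⟩ := exists_crt hu b
    refine ⟨Φ (C ψ * c), (hf _).trans (DFinsupp.ext fun i => ?_)⟩
    refine (toSumWittExt_apply _ i).trans (Eq.trans ?_ (hb i))
    refine (bracketPresentation_toWittExt (u i)).map_eq_of_dvd_sub ?_
    have h1 : C θ * (C ψ * c) - b i = (c - b i) - C φ * C v * c := by
      linear_combination c * hψ'
    rw [h1]
    exact dvd_sub (hc i) (Dvd.dvd.mul_right (Dvd.dvd.mul_left (_root_.map_dvd C (hdvd i)) _) _)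
  · obtain ⟨a, rfl⟩ := P.surjective z
    rw [P.map_mem_idealOf_iff hvq, ← hzero, ← hf]
    rfl

theorem BracketPresentation.nonempty_quotient_lieEquiv
    (hu : Pairwise fun i j => IsCoprime (u i) (u j)) (hvu : v = ∏ i, u i) (hv : v ∣ π)
    (hvq : v ∣ q) : Nonempty ((𝔤 ⧸ P.idealOf hv) ≃ₗ⁅F⁆ ⨁ i, WittExt (u i)) := by
  obtain ⟨f, hf, hker⟩ := P.exists_lieHom hu hvu hv hvq
  have h1 : f.ker = P.idealOf hv := by
    ext z
    rw [LieHom.mem_ker, hker]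
  have h2 : f.range = ⊤ := by
    rw [LieHom.range_eq_top]; exact hf
  rw [← h1]
  exact ⟨f.quotKerEquivRange.trans ((LieEquiv.ofEq _ _ (by rw [h2])).trans LieSubalgebra.topEquiv)⟩

theorem BracketPresentation.nonempty_lieEquiv
    (hu : Pairwise fun i j => IsCoprime (u i) (u j)) (hvu : v = ∏ i, u i) (hv : v ∣ π)
    (hvq : v ∣ q) (hbot : P.idealOf hv = ⊥) : Nonempty (𝔤 ≃ₗ⁅F⁆ ⨁ i, WittExt (u i)) := by
  obtain ⟨f, hf, hker⟩ := P.exists_lieHom hu hvu hv hvq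
  refine ⟨LieEquiv.ofBijective f ⟨?_, hf⟩⟩
  rw [injective_iff_map_eq_zero]
  intro z hz
  rwa [hker, hbot, LieSubmodule.mem_bot] at hz

end Quotient

/-! ### The radical of `q` and the main theorem. -/

section Main

variable {F : Type*} [Field F]

theorem isRadical_prod_of_irreducible {ι : Type*} (s : Finset ι) {u : ι → F[X]}
    (hirr : ∀ i, Irreducible (u i)) (hcop : Pairwise fun i j => IsCoprime (u i) (u j)) :
    IsRadical (∏ i ∈ s, u i) := fun _ _ hr =>
  Finset.prod_dvd_of_coprime (fun _ _ _ _ hij => hcop hij) fun i hi =>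
    (hirr i).prime.dvd_of_dvd_pow ((Finset.dvd_prod_of_mem u hi).trans hr)

end Main
end HH

end

theorem mainTheorem7 {F : Type*} [Field F] [CharZero F] (h : F[X])
    (t : ℕ) (u : Fin t → F[X]) (α : Fin t → ℕ) (c : F) (hc : c ≠ 0)
    (hmonic : ∀ i, (u i).Monic) (hirr : ∀ i, Irreducible (u i)) (hinj : Function.Injective u)
    (hα : ∀ i, 1 ≤ α i) (hh : h = C c * ∏ i, u i ^ α i) :
    -- `HH¹(A_h)` is the direct sum of its center and its derived algebra
    (IsCompl (LieAlgebra.center F (HH.HH1 F (HH.Alg h)))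
        (HH.derivedIdeal F (HH.HH1 F (HH.Alg h))) ∧
      -- the center consists of the classes of `D_{r h / π_h}`, `deg r < deg π_h`
      (LieAlgebra.center F (HH.HH1 F (HH.Alg h)) : Set (HH.HH1 F (HH.Alg h))) =
        {z | ∃ r : F[X], r.degree < (HH.piPoly h).degree ∧
          z = HH.cls (HH.polyDer h (r * (h / HH.piPoly h)))} ∧
      Module.rank F (LieAlgebra.center F (HH.HH1 F (HH.Alg h))) = (HH.piPoly h).natDegree) ∧
    ∃ N : LieIdeal F (HH.derivedIdeal F (HH.HH1 F (HH.Alg h))),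
      -- `N` is the span of the classes of `ad_{r a_n}`, with `r` divisible by each multiple prime
      N.toSubmodule.map (HH.derivedIdeal F (HH.HH1 F (HH.Alg h))).toSubmodule.subtype =
        HH.adSpan h (∏ i with 1 < α i, u i) ∧
      -- `N` is the unique maximal nilpotent ideal of the derived algebra
      IsGreatest {I : LieIdeal F (HH.derivedIdeal F (HH.HH1 F (HH.Alg h))) |
        LieRing.IsNilpotent I} N ∧
      -- the quotient is a direct sum of simple Lie algebras `(F[x] / u_i) ⊗ W`
      (∀ i, 1 < α i → LieAlgebra.IsSimple F (HH.WittExt (u i))) ∧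
      Nonempty ((HH.derivedIdeal F (HH.HH1 F (HH.Alg h)) ⧸ N) ≃ₗ⁅F⁆
        ⨁ i : {i : Fin t // 1 < α i}, HH.WittExt (u i)) ∧
      -- all multiplicities at most `2`
      ((∀ i, α i ≤ 2) → N = ⊥) ∧
      ((∀ i, α i = 1) → HH.derivedIdeal F (HH.HH1 F (HH.Alg h)) = ⊥) ∧
      ((∀ i, α i ≤ 2) → (∃ i, α i = 2) →
        Nonempty (HH.derivedIdeal F (HH.HH1 F (HH.Alg h)) ≃ₗ⁅F⁆
          ⨁ i : {i : Fin t // α i = 2}, HH.WittExt (u i))) ∧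
      -- some multiplicity at least `3`
      ((∃ i, 3 ≤ α i) → N ≠ ⊥ ∧
        ¬ LieRing.IsNilpotent (HH.derivedIdeal F (HH.HH1 F (HH.Alg h))) ∧
        ¬ LieAlgebra.IsSemisimple F (HH.derivedIdeal F (HH.HH1 F (HH.Alg h))) ∧
        ¬ LieAlgebra.HasTrivialRadical F (HH.derivedIdeal F (HH.HH1 F (HH.Alg h)))) := by
  have hcop : Pairwise fun i j => IsCoprime (u i) (u j) := fun i j hij =>
    HH.isCoprime_of_monic_irreducible (hmonic i) (hmonic j) (hirr i) (hirr j) fun e => hij (hinj e)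
  have H := HH.radicalFactor_prod hmonic hirr hinj α hα hc hh
  have hpi : HH.piPoly h = ∏ i, u i := HH.piPoly_prod hmonic hirr hinj α hα hc hh
  have hdiv : h / HH.piPoly h = C c * ∏ i, u i ^ (α i - 1) := by
    rw [hpi]
    refine (EuclideanDomain.eq_div_of_mul_eq_right H.monic.ne_zero ?_).symm
    exact H.eq_mul.symm
  have hvπ : (∏ i with 1 < α i, u i) ∣ ∏ i, u i :=
    Finset.prod_dvd_prod_of_subset _ _ _ (Finset.subset_univ _)
  have hvq : (∏ i with 1 < α i, u i) ∣ C c * ∏ i, u i ^ (α i - 1) := by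
    refine Dvd.dvd.mul_left ((Finset.prod_dvd_prod_of_dvd _ _ fun i hi => ?_).trans
      (Finset.prod_dvd_prod_of_subset _ _ _ (Finset.subset_univ _))) _
    have := (Finset.mem_filter.1 hi).2
    exact dvd_pow_self _ (by omega)
  have hCc : IsUnit (C c : F[X]) := isUnit_C.2 hc.isUnit
  -- Any exponent at least every `α i - 1` works; the sum of the `α i` is a convenient one.
  have hqv : ∃ n, C c * ∏ i, u i ^ (α i - 1) ∣ (∏ i with 1 < α i, u i) ^ n := by
    refine ⟨∑ i, α i, ?_⟩
    rw [hCc.mul_left_dvd]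
    refine Finset.prod_dvd_of_coprime (fun i _ j _ hij => (hcop hij).pow) fun i _ => ?_
    by_cases hi : 1 < α i
    · refine (pow_dvd_pow_of_dvd (Finset.dvd_prod_of_mem u
        (Finset.mem_filter.2 ⟨Finset.mem_univ i, hi⟩)) _).trans (pow_dvd_pow _ ?_)
      exact (Nat.sub_le _ _).trans (Finset.single_le_sum (f := α) (fun _ _ => Nat.zero_le _)
        (Finset.mem_univ i))
    · rw [show α i - 1 = 0 by omega, pow_zero]; exact one_dvd _
  have hrad := HH.isRadical_prod_of_irreducible (Finset.univ.filter fun i => 1 < α i) hirr hcop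
  have hq2 : (∀ i, α i ≤ 2) → C c * ∏ i, u i ^ (α i - 1) ∣ ∏ i with 1 < α i, u i := by
    intro h2
    rw [hCc.mul_left_dvd, Finset.prod_filter]
    refine Finset.prod_dvd_prod_of_dvd _ _ fun i _ => ?_
    split_ifs with hi
    · rw [show α i - 1 = 1 by have := h2 i; omega, pow_one]
    · rw [show α i - 1 = 0 by omega, pow_zero]
  obtain ⟨Θ, P⟩ := HH.exists_outerPresentation H hpi
  have B := P.bracketPresentation
  rw [hdiv, hpi]
  refine ⟨⟨P.isCompl_center_derivedIdeal, P.coe_center_eq, P.rank_center⟩,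
    P.bracketPresentation.idealOf hvπ, P.map_idealOf hvπ, ⟨?_, ?_⟩, ?_, ?_, ?_, ?_, ?_, ?_⟩
  · obtain ⟨n, hn⟩ := hqv
    exact B.isNilpotent_idealOf hvπ hn
  · intro I hI
    exact B.le_idealOf_of_isNilpotent hvπ hvq hrad I hI
  · exact fun i _ => HH.isSimple_wittExt (hirr i)
  · refine B.nonempty_quotient_lieEquiv (u := fun i : {i // 1 < α i} => u i)
      (fun i j hij => hcop fun e => hij (Subtype.ext e)) ?_ hvπ hvq
    exact Finset.prod_subtype _ (by simp) u
  · exact fun h2 => B.idealOf_eq_bot_iff.2 (hq2 h2)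
  · intro h1
    refine P.derivedIdeal_eq_bot ?_
    simpa [h1] using hc
  · intro h2 _
    refine B.nonempty_lieEquiv (u := fun i : {i // α i = 2} => u i)
      (fun i j hij => hcop fun e => hij (Subtype.ext e)) ?_ hvπ hvq
      (B.idealOf_eq_bot_iff.2 (hq2 h2))
    refine Finset.prod_subtype _ (fun i => ?_) u
    have := h2 i
    simp only [Finset.mem_filter, Finset.mem_univ, true_and]
    omega
  · rintro ⟨i, hi⟩
    -- A prime with `α i ≥ 3` has its square dividing `q`, while `v` is squarefree; so `q ∤ v`.
    have hne : P.bracketPresentation.idealOf hvπ ≠ ⊥ := by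
      rw [Ne, B.idealOf_eq_bot_iff]
      intro hd
      refine (hirr i).not_isUnit (hrad.squarefree (Finset.prod_ne_zero_iff.2
        fun i _ => (hirr i).ne_zero) (u i) ?_)
      rw [← pow_two]
      refine (Dvd.dvd.mul_left ((pow_dvd_pow _ (by omega)).trans (Finset.dvd_prod_of_mem
        (fun i => u i ^ (α i - 1)) (Finset.mem_univ i))) _).trans hd
    have hnil : LieRing.IsNilpotent (P.bracketPresentation.idealOf hvπ) := by
      obtain ⟨n, hn⟩ := hqv
      exact B.isNilpotent_idealOf hvπ hn
    have hnot := HH.not_hasTrivialRadical_of_isNilpotent hnil hne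
    refine ⟨hne, B.not_isNilpotent fun hu => ?_, fun hss => hnot inferInstance, hnot⟩
    refine (hirr i).not_isUnit (isUnit_of_dvd_unit ?_ hu)
    exact Dvd.dvd.mul_left ((dvd_pow_self _ (by omega)).trans
      (Finset.dvd_prod_of_mem (fun i => u i ^ (α i - 1)) (Finset.mem_univ i))) _
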